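/- Let $H$ be a real separable Hilbert space with norm $|\cdot|$, and let $A:D(A)\subset H\to H$ be a self-adjoint, negative definite operator such that $(-A)^{-1+\delta}$ is of trace class for some $\delta\in(0,1)$. Let $C>0$ and $p>0$. There is a constant $C_p>0$, depending only on $A$, $C$ and $p$, such that the following holds. Let $B:H\to H$ be Borel measurable, bounded on balls, and such that $$\langle B(y+z),y\rangle\le C\big(|y|^2+e^{p|z|}+1\big)\qquad\text{for all }y,z\in H .$$ Let $(e_k)$ be an orthonormal basis of $H$ with $Ae_k=-\lambda_ke_k$, let $x\in H$, and let $(\Omega,\mathcal F,(\mathcal F_t),\mathbb P,W,X)$ be a weak mild solution of $dX_t=(AX_t+B(X_t))\,dt+dW_t$, $X_0=x$. That is, $(\Omega,\mathcal F,(\mathcal F_t),\mathbb P)$ is a filtered probability space, $W_t=\sum_k\beta_k(t)e_k$ is a cylindrical $(\mathcal F_t)$-Wiener process (the $\beta_k$ are independent real Brownian motions, adapted to $(\mathcal F_t)$, and their increments after any time $s$ are jointly independent of $\mathcal F_s$), and $X$ is a continuous adapted $H$-valued process such that, $\mathbb P$-a.s., $$X_t=e^{tA}x+\int_0^te^{(t-s)A}B(X_s)\,ds+\int_0^te^{(t-s)A}\,dW_s\qquad\text{for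 all }t\ge0 .$$ Let $Z$ be the continuous version of the Ornstein–Uhlenbeck process $Z_t=e^{tA}x+\int_0^te^{(t-s)A}\,dW_s$. Then for every $T>0$ $$K_T:=\mathbb E\Big[\sup_{t\in[0,T]}e^{p|Z_t|}\Big]<\infty \qquad\text{and}\qquad \mathbb E\Big[\sup_{t\in[0,T]}|X_t|^2\Big]\le e^{C_pT}\big(|x|^2+K_T+1\big).$$ -/

import Mathlib

open MeasureTheory ProbabilityTheory Filter Topology
open scoped NNReal ENNReal RealInnerProductSpace

noncomputable section

namespace OUDrift

section Operators

variable {H : Type*} [NormedAddCommGroup H] [InnerProductSpace ℝ H]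

open Classical in
/-- The resolvent `(μ I - A)⁻¹ x` of a partially defined operator `A`
(the value is `0` if `x` is not in the range of `μ I - A`). -/
def resolventFun (A : H →ₗ.[ℝ] H) (μ : ℝ) (x : H) : H :=
  if h : ∃ y : A.domain, μ • (y : H) - A y = x then (h.choose : H) else 0

/-- The semigroup `e^{tA}`, given by Hille's exponential formula
`e^{tA} x = lim_n (I - (t/n) A)^{-n} x = lim_n ((n/t) ((n/t) I - A)⁻¹)^n x` for `t > 0`,
and `e^{0A} = I`. Only the times `t ≥ 0` are meaningful. -/
def expOp (A : H →ₗ.[ℝ] H) (t : ℝ) (x : H) : H :=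
  if t ≤ 0 then x
  else limUnder atTop fun n : ℕ ↦ (fun y ↦ ((n : ℝ) / t) • resolventFun A ((n : ℝ) / t) y)^[n] x

/-- The negative fractional power `(-A)^{-α}`, `α > 0`, given by
`(-A)^{-α} x = Γ(α)⁻¹ ∫_0^∞ s^{α-1} e^{sA} x ds`. -/
def negFracPow (A : H →ₗ.[ℝ] H) (α : ℝ) (x : H) : H :=
  (Real.Gamma α)⁻¹ • ∫ s in Set.Ioi (0 : ℝ), s ^ (α - 1) • expOp A s x

/-- Trace class (nuclear) operators on a Hilbert space: `R x = ∑ ⟨a n, x⟩ b n` for all `x`, with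
`∑ |a n| |b n| < ∞`. -/
def IsTraceClass (R : H → H) : Prop :=
  ∃ a b : ℕ → H, Summable (fun n ↦ ‖a n‖ * ‖b n‖) ∧
    ∀ x, HasSum (fun n ↦ ⟪a n, x⟫ • b n) (R x)

/-- `A` is self-adjoint and negative definite, and for some `δ ∈ (0,1)` the operator
`(-A)^{-1+δ}` is everywhere defined (the integral defining it converges at every `x`) and of
trace class. -/
structure Hypothesis1 [CompleteSpace H] (A : H →ₗ.[ℝ] H) : Prop where
  selfAdjoint : IsSelfAdjoint A
  negDef : ∀ y : A.domain, (y : H) ≠ 0 → ⟪A y, (y : H)⟫ < 0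
  traceClass : ∃ δ : ℝ, 0 < δ ∧ δ < 1 ∧
    (∀ x, IntegrableOn (fun s : ℝ ↦ s ^ ((1 - δ) - 1) • expOp A s x) (Set.Ioi 0)) ∧
    IsTraceClass (negFracPow A (1 - δ))

/-- `e` is an orthonormal basis of `H` with `e k ∈ D(A)` and `A (e k) = - lam k • e k`. -/
def IsEigenbasis {ι : Type*} (A : H →ₗ.[ℝ] H) (e : HilbertBasis ι ℝ H) (lam : ι → ℝ) : Prop :=
  ∀ k, ∃ h : e k ∈ A.domain, A ⟨e k, h⟩ = -(lam k • e k)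

/-- Functions that are bounded on balls. -/
def LocallyBdd (B : H → H) : Prop :=
  ∀ r : ℝ, ∃ M : ℝ, ∀ x, ‖x‖ ≤ r → ‖B x‖ ≤ M

end Operators

section Processes

variable {Ω ι : Type*} {mΩ : MeasurableSpace Ω}

/-- `W = ∑ k, β k e k` is a cylindrical `(𝓕 t)`-Wiener process, given by its coordinates: the `β k`
are independent real Brownian motions, adapted to `𝓕`, and the increments after time `s` of the
whole family are independent of `𝓕 s`. -/
structure IsCylindricalWiener (𝓕 : Filtration ℝ≥0 mΩ) (P : Measure Ω)
    (β : ι → ℝ≥0 → Ω → ℝ) : Prop where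
  brownian : ∀ k, IsBrownianReal (β k) P
  indep : iIndepFun (fun k ω (t : ℝ≥0) ↦ β k t ω) P
  adapted : ∀ k, StronglyAdapted 𝓕 (β k)
  indep_increments : ∀ s : ℝ≥0,
    Indep (MeasurableSpace.comap
      (fun ω (q : ι × Set.Ici s) ↦ β q.1 q.2 ω - β q.1 s ω) MeasurableSpace.pi) (𝓕 s) P

/-- The random variable `I` is (a version of) the Wiener integral `∫_0^t f(s) db_s` of a continuous
deterministic `f`: the limit in probability of the left-point sums over the uniform partitions
of `[0,t]`. -/
def IsWienerIntegral (P : Measure Ω) (b : ℝ≥0 → Ω → ℝ) (f : ℝ → ℝ) (t : ℝ≥0) (I : Ω → ℝ) : Prop :=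
  TendstoInMeasure P
    (fun (n : ℕ) ω ↦ ∑ i ∈ Finset.range n,
      f ((i : ℝ) * t / n) *
        (b (((i : ℝ≥0) + 1) * t / n) ω - b ((i : ℝ≥0) * t / n) ω))
    atTop I

variable {H : Type*} [NormedAddCommGroup H] [InnerProductSpace ℝ H]

/-- `V` is a continuous `H`-valued version of the stochastic convolution
`∫_0^t e^{(t-s)A} dW_s = ∑ k, (∫_0^t e^{-lam k (t-s)} dβ_k(s)) e k`, where `W = ∑ k, β k e k` and
`e^{tA} e k = e^{-lam k t} e k`. -/
structure IsStochasticConvolution (P : Measure Ω) (e : HilbertBasis ι ℝ H) (lam : ι → ℝ)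
    (β : ι → ℝ≥0 → Ω → ℝ) (V : ℝ≥0 → Ω → H) : Prop where
  continuous : ∀ᵐ ω ∂P, Continuous fun t ↦ V t ω
  coord : ∀ (t : ℝ≥0) (k : ι),
    IsWienerIntegral P (β k) (fun s ↦ Real.exp (-lam k * (t - s))) t (fun ω ↦ ⟪e k, V t ω⟫)

/-- `Z` is the (continuous) Ornstein-Uhlenbeck process
`Z_t = Z(t,x) = e^{tA} x + ∫_0^t e^{(t-s)A} dW_s`. -/
def IsOrnsteinUhlenbeck (A : H →ₗ.[ℝ] H) (P : Measure Ω) (e : HilbertBasis ι ℝ H) (lam : ι → ℝ)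
    (β : ι → ℝ≥0 → Ω → ℝ) (x : H) (Z : ℝ≥0 → Ω → H) : Prop :=
  (∀ᵐ ω ∂P, Continuous fun t ↦ Z t ω) ∧
  IsStochasticConvolution P e lam β fun t ω ↦ Z t ω - expOp A t x

/-- `(Ω, 𝓕, P, W, X)` with `W = ∑ k, β k e k` is a weak mild solution of
`dX = (A X + B(X)) dt + dW`, `X_0 = x`: `W` is a cylindrical `𝓕`-Wiener process, `X` is continuous
and adapted, and almost surely, for all `t`,
`X_t = e^{tA} x + ∫_0^t e^{(t-s)A} B(X_s) ds + ∫_0^t e^{(t-s)A} dW_s`. -/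
structure IsWeakMildSolution (A : H →ₗ.[ℝ] H) (B : H → H) (x : H) (e : HilbertBasis ι ℝ H)
    (lam : ι → ℝ) (𝓕 : Filtration ℝ≥0 mΩ) (P : Measure Ω) (β : ι → ℝ≥0 → Ω → ℝ)
    (X : ℝ≥0 → Ω → H) : Prop where
  wiener : IsCylindricalWiener 𝓕 P β
  adapted : StronglyAdapted 𝓕 X
  continuous : ∀ᵐ ω ∂P, Continuous fun t ↦ X t ω
  mild : ∃ V : ℝ≥0 → Ω → H, IsStochasticConvolution P e lam β V ∧
    ∀ᵐ ω ∂P, ∀ t : ℝ≥0,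
      X t ω = expOp A t x + (∫ s in (0 : ℝ)..t, expOp A (t - s) (B (X s.toNNReal ω))) + V t ω

/-- `K_T = E [sup_{t ≤ T} e^{p |Z_t|}]`, as an element of `[0, ∞]`. -/
def expSupMoment (P : Measure Ω) (p : ℝ) (Z : ℝ≥0 → Ω → H) (T : ℝ≥0) : ℝ≥0∞ :=
  ∫⁻ ω, ⨆ t ∈ Set.Icc 0 T, ENNReal.ofReal (Real.exp (p * ‖Z t ω‖)) ∂P

end Processes

end OUDrift

end

/-! In an eigenbasis everything is diagonal: `expOp A t` multiplies the `k`-th coordinate by `exp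
(-lam k * t)`, and the trace condition becomes `∑ lam k ^ (-(1 - δ)) ≤ L` with `L` independent of
the basis (`exists_sum_rpow_le`).

The noise is handled pathwise. Dyadic chaining makes each Brownian coordinate `γ`-Hölder with `γ =
(1 - δ) / 2`; summation by parts then bounds the `k`-th coordinate of the convolution by its Hölder
constant times `lam k ^ (-γ)`. The squares are summable, and `sup ‖V‖² ≤ a T^δ (1 + log G)` with `E
G ≤ N` (`exists_sup_stochasticConvolution_le`). Since `p‖V‖` is at most a constant plus `1 + log G`,
the supremum of `exp (p‖Z‖)` is at most a constant times `G`, so `K_T` is finite.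

The difference `Y = X - Z` solves `Y' = A Y + B (Y + Z)` in the mild sense with `Y 0 = 0`. The
energy inequality, the growth condition and Gronwall give `‖Y‖² ≤ (R + 1) (exp (2CT) - 1)`, where
`R` bounds `exp (p‖Z‖)` on `[0,T]` (`IsEigenbasis.norm_sub_sq_le`).

Comparing `‖Z‖²` with `exp (p‖Z‖)` yields the estimate with a prefactor larger than `1`. For `T ≥
T₀` the exponential absorbs it. For `T ≤ T₀` the factor `exp (Cp T)` is close to `1`, so Young's
inequality with a small parameter is used, together with the smallness of `exp (2CT) - 1` and `T^δ`.
-/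

namespace OUDrift

/-! ### Coordinates in a Hilbert basis. -/

section HilbertBasisCoordinates

variable {H : Type*} [NormedAddCommGroup H] [InnerProductSpace ℝ H] {ι : Type*}

lemma HilbertBasis.ext_inner (e : HilbertBasis ι ℝ H) {x y : H}
    (h : ∀ k, ⟪e k, x⟫ = ⟪e k, y⟫) : x = y := by
  apply e.repr.injective
  ext k
  simpa [HilbertBasis.repr_apply_apply] using h k

lemma HilbertBasis.hasSum_inner_sq (e : HilbertBasis ι ℝ H) (x : H) :
    HasSum (fun k ↦ ⟪e k, x⟫ ^ 2) (‖x‖ ^ 2) := by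
  have := e.hasSum_inner_mul_inner x x
  rw [real_inner_self_eq_norm_sq] at this
  simpa only [real_inner_comm x, ← sq] using this

lemma HilbertBasis.norm_le_of_abs_inner_le (e : HilbertBasis ι ℝ H) {x y : H}
    (h : ∀ k, |⟪e k, x⟫| ≤ |⟪e k, y⟫|) : ‖x‖ ≤ ‖y‖ := by
  have := hasSum_le (fun k ↦ sq_le_sq.2 (h k)) (hasSum_inner_sq e x) (hasSum_inner_sq e y)
  exact (sq_le_sq₀ (norm_nonneg _) (norm_nonneg _)).1 this

lemma HilbertBasis.exists_inner_eq_mul (e : HilbertBasis ι ℝ H) (c : ι → ℝ) {M : ℝ}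
    (hc : ∀ k, |c k| ≤ M) (x : H) : ∃ y : H, ∀ k, ⟪e k, y⟫ = c k * ⟪e k, x⟫ := by
  have hmem : Memℓp (fun k ↦ c k * ⟪e k, x⟫) 2 := by
    rw [memℓp_gen_iff (by norm_num)]
    have := (hasSum_inner_sq e x).summable.mul_left (M ^ 2)
    refine Summable.of_nonneg_of_le (fun _ ↦ by positivity) (fun k ↦ ?_) this
    simp only [ENNReal.toReal_ofNat, Real.rpow_ofNat, norm_mul, mul_pow, Real.norm_eq_abs, sq_abs]
    refine mul_le_mul_of_nonneg_right ?_ (sq_nonneg _)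
    exact sq_le_sq' (abs_le.1 (hc k)).1 (abs_le.1 (hc k)).2
  refine ⟨e.repr.symm ⟨_, hmem⟩, fun k ↦ ?_⟩
  rw [← HilbertBasis.repr_apply_apply, LinearIsometryEquiv.apply_symm_apply]

/-- Basis vectors lie at mutual distance `√2`, so balls of radius `1/2` around them are disjoint.
Countability allows almost sure statements to be intersected over all coordinates. -/
lemma HilbertBasis.countable [TopologicalSpace.SeparableSpace H] (e : HilbertBasis ι ℝ H) :
    Countable ι := by
  have hd : Pairwise fun i j ↦ Disjoint (Metric.ball (e i) (1 / 2)) (Metric.ball (e j) (1 / 2)) := by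
    intro i j hij
    refine Metric.ball_disjoint_ball ?_
    have h := norm_sub_sq_real (e i) (e j)
    rw [e.orthonormal.1, e.orthonormal.1, e.orthonormal.2 hij] at h
    rw [dist_eq_norm]
    nlinarith [norm_nonneg (e i - e j)]
  exact hd.countable_of_isOpen_disjoint (fun _ ↦ Metric.isOpen_ball)
    fun i ↦ ⟨e i, Metric.mem_ball_self (by norm_num)⟩

end HilbertBasisCoordinates

/-! ### The semigroup and the trace condition in an eigenbasis. -/

section Semigroup

variable {H : Type*} [NormedAddCommGroup H] [InnerProductSpace ℝ H]
  {A : H →ₗ.[ℝ] H} {ι : Type*} {e : HilbertBasis ι ℝ H} {lam : ι → ℝ}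

lemma IsEigenbasis.lam_pos (he : IsEigenbasis A e lam)
    (hneg : ∀ y : A.domain, (y : H) ≠ 0 → ⟪A y, (y : H)⟫ < 0) (k : ι) : 0 < lam k := by
  obtain ⟨h, hk⟩ := he k
  have := hneg ⟨e k, h⟩ (e.orthonormal.ne_zero k)
  rw [hk, inner_neg_left, real_inner_smul_left, real_inner_self_eq_norm_sq,
    e.orthonormal.1 k] at this
  linarith

variable [CompleteSpace H]

lemma IsEigenbasis.inner_apply (he : IsEigenbasis A e lam) (hA : IsSelfAdjoint A) (k : ι)
    (y : A.domain) : ⟪e k, A y⟫ = -lam k * ⟪e k, (y : H)⟫ := by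
  obtain ⟨h, hk⟩ := he k
  have hf : A.IsFormalAdjoint A := by
    have := LinearPMap.adjoint_isFormalAdjoint hA.dense_domain
    rwa [LinearPMap.isSelfAdjoint_def.1 hA] at this
  have := hf ⟨e k, h⟩ y
  rw [hk, inner_neg_left, real_inner_smul_left] at this
  linarith

/-- The vector with these coordinates is in the domain of the adjoint, hence of `A`, so the
resolvent equation is solvable. Testing against `e k` shows that any solution has these coordinates,
in particular the chosen one. -/
lemma IsEigenbasis.inner_resolventFun (he : IsEigenbasis A e lam) (hA : IsSelfAdjoint A)
    (hlam : ∀ k, 0 < lam k) {μ : ℝ} (hμ : 0 < μ) (x : H) (k : ι) :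
    ⟪e k, resolventFun A μ x⟫ = (μ + lam k)⁻¹ * ⟪e k, x⟫ := by
  have hex : ∃ y : A.domain, μ • (y : H) - A y = x := by
    obtain ⟨y, hy⟩ := HilbertBasis.exists_inner_eq_mul e (fun k ↦ (μ + lam k)⁻¹) (M := μ⁻¹)
      (fun k ↦ by
        rw [abs_of_pos (inv_pos.2 (add_pos hμ (hlam k)))]
        exact inv_anti₀ hμ (by linarith [hlam k])) x
    have hw : ∀ v : A.domain, ⟪μ • y - x, (v : H)⟫ = ⟪y, A v⟫ := by
      intro v
      refine (e.hasSum_inner_mul_inner _ _).unique ?_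
      convert e.hasSum_inner_mul_inner y (A v) using 2 with k
      rw [he.inner_apply hA, real_inner_comm, inner_sub_right, real_inner_smul_right,
        real_inner_comm _ y, hy]
      have := (add_pos hμ (hlam k)).ne'
      field_simp
      ring
    have hd := LinearPMap.mem_adjoint_domain_of_exists y ⟨_, hw⟩
    obtain ⟨hd', hv⟩ : ∃ h : y ∈ A.domain, A ⟨y, h⟩ = μ • y - x := by
      have : ∃ h : y ∈ A.adjoint.domain, A.adjoint ⟨y, h⟩ = μ • y - x :=
        ⟨hd, LinearPMap.adjoint_apply_eq hA.dense_domain ⟨y, hd⟩ hw⟩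
      rwa [LinearPMap.isSelfAdjoint_def.1 hA] at this
    refine ⟨⟨y, hd'⟩, ?_⟩
    rw [hv]
    simp
  rw [resolventFun, dif_pos hex]
  have h2 := congrArg (fun z ↦ ⟪e k, z⟫) hex.choose_spec
  simp only [inner_sub_right, real_inner_smul_right, he.inner_apply hA] at h2
  rw [← h2]
  have := (add_pos hμ (hlam k)).ne'
  field_simp
  ring

/-- In coordinates Hille's formula reads `(1 + lam k * t / n)⁻ⁿ → exp (-lam k * t)`. All factors lie
in `[0,1]`, so dominated convergence in Parseval's sum upgrades this to convergence in norm, which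
is what evaluates `limUnder`. -/
lemma IsEigenbasis.inner_expOp (he : IsEigenbasis A e lam) (hA : IsSelfAdjoint A)
    (hlam : ∀ k, 0 < lam k) {t : ℝ} (ht : 0 ≤ t) (x : H) (k : ι) :
    ⟪e k, expOp A t x⟫ = Real.exp (-lam k * t) * ⟪e k, x⟫ := by
  rcases ht.eq_or_lt with rfl | ht
  · simp [expOp]
  obtain ⟨y, hy⟩ := HilbertBasis.exists_inner_eq_mul e (fun k ↦ Real.exp (-lam k * t)) (M := 1)
    (fun k ↦ by
      rw [Real.abs_exp]
      exact Real.exp_le_one_iff.2 (by nlinarith [hlam k])) x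
  set u : ℕ → H := fun n ↦ (fun y ↦ ((n : ℝ) / t) • resolventFun A ((n : ℝ) / t) y)^[n] x with hu
  have hcoord : ∀ n : ℕ, n ≠ 0 → ∀ k, ⟪e k, u n⟫ = ((1 + lam k * t / n)⁻¹) ^ n * ⟪e k, x⟫ := by
    intro n hn k
    have hn' : 0 < (n : ℝ) := by positivity
    have hit : ∀ m : ℕ, ⟪e k, (fun y ↦ ((n : ℝ) / t) • resolventFun A ((n : ℝ) / t) y)^[m] x⟫
        = ((1 + lam k * t / n)⁻¹) ^ m * ⟪e k, x⟫ := by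
      intro m
      induction m with
      | zero => simp
      | succ m ih =>
        rw [Function.iterate_succ_apply', real_inner_smul_right,
          he.inner_resolventFun hA hlam (div_pos hn' ht), ih, pow_succ']
        have : (n : ℝ) / t * (n / t + lam k)⁻¹ = (1 + lam k * t / n)⁻¹ := by
          have := hlam k
          field_simp
        rw [← this]; ring
    exact hit n
  have hlim : Tendsto u atTop (𝓝 y) := by
    rw [tendsto_iff_norm_sub_tendsto_zero]
    have hs : Tendsto (fun n ↦ ∑' k, ⟪e k, u n - y⟫ ^ 2) atTop (𝓝 (∑' _ : ι, (0 : ℝ))) := by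
      refine tendsto_tsum_of_dominated_convergence (bound := fun k ↦ ⟪e k, x⟫ ^ 2)
        (HilbertBasis.hasSum_inner_sq e x).summable (fun k ↦ ?_) ?_
      · have h1 : Tendsto (fun n : ℕ ↦ ((1 + lam k * t / n)⁻¹) ^ n) atTop
            (𝓝 (Real.exp (-lam k * t))) := by
          have := (Real.tendsto_one_add_div_pow_exp (lam k * t)).inv₀ (Real.exp_pos _).ne'
          rw [← Real.exp_neg, ← neg_mul] at this
          simpa using this
        have h2 : Tendsto (fun n : ℕ ↦ (((1 + lam k * t / n)⁻¹) ^ n * ⟪e k, x⟫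
            - Real.exp (-lam k * t) * ⟪e k, x⟫) ^ 2) atTop (𝓝 0) := by
          have := ((h1.mul_const ⟪e k, x⟫).sub_const (Real.exp (-lam k * t) * ⟪e k, x⟫)).pow 2
          simpa using this
        refine h2.congr' ?_
        filter_upwards [eventually_ne_atTop 0] with n hn
        rw [inner_sub_right, hcoord n hn, hy]
      · filter_upwards [eventually_ne_atTop 0] with n hn k
        rw [inner_sub_right, hcoord n hn, hy, ← sub_mul, Real.norm_eq_abs, abs_of_nonneg (by positivity),
          mul_pow]
        have hl := hlam k
        have h1 : 0 ≤ ((1 + lam k * t / n)⁻¹) ^ n := by positivity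
        have h2 : ((1 + lam k * t / n)⁻¹) ^ n ≤ 1 :=
          pow_le_one₀ (by positivity) (inv_le_one_of_one_le₀ (by
            have : 0 ≤ lam k * t / n := by positivity
            linarith))
        have h3 := Real.exp_pos (-lam k * t)
        have h4 : Real.exp (-lam k * t) ≤ 1 := Real.exp_le_one_iff.2 (by nlinarith)
        have h5 : (((1 + lam k * t / n)⁻¹) ^ n - Real.exp (-lam k * t)) ^ 2 ≤ 1 := by
          rw [sq_le_one_iff_abs_le_one, abs_le]
          constructor <;> linarith
        exact mul_le_of_le_one_left (by positivity) h5
    simp only [(HilbertBasis.hasSum_inner_sq e _).tsum_eq, tsum_zero] at hs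
    simpa using hs.sqrt
  rw [expOp, if_neg ht.not_ge, hlim.limUnder_eq, hy]

lemma IsEigenbasis.norm_expOp_le (he : IsEigenbasis A e lam) (hA : IsSelfAdjoint A)
    (hlam : ∀ k, 0 < lam k) {t : ℝ} (ht : 0 ≤ t) (x : H) : ‖expOp A t x‖ ≤ ‖x‖ := by
  refine HilbertBasis.norm_le_of_abs_inner_le e fun k ↦ ?_
  rw [he.inner_expOp hA hlam ht, abs_mul, Real.abs_exp]
  exact mul_le_of_le_one_left (abs_nonneg _) (Real.exp_le_one_iff.2 (by nlinarith [hlam k]))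

lemma IsEigenbasis.expOp_apply_basis (he : IsEigenbasis A e lam) (hA : IsSelfAdjoint A)
    (hlam : ∀ k, 0 < lam k) {t : ℝ} (ht : 0 ≤ t) (k : ι) :
    expOp A t (e k) = Real.exp (-lam k * t) • e k := by
  classical
  refine HilbertBasis.ext_inner e fun j ↦ ?_
  rw [he.inner_expOp hA hlam ht, real_inner_smul_right]
  rcases eq_or_ne j k with rfl | h
  · rfl
  · simp [e.orthonormal.2 h]

lemma IsEigenbasis.negFracPow_apply_basis (he : IsEigenbasis A e lam) (hA : IsSelfAdjoint A)
    (hlam : ∀ k, 0 < lam k) {α : ℝ} (hα : 0 < α) (k : ι) :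
    negFracPow A α (e k) = lam k ^ (-α) • e k := by
  have h1 : ∫ s in Set.Ioi (0 : ℝ), s ^ (α - 1) • expOp A s (e k)
      = ∫ s in Set.Ioi (0 : ℝ), (s ^ (α - 1) * Real.exp (-(lam k * s))) • e k := by
    refine setIntegral_congr_fun measurableSet_Ioi fun s hs ↦ ?_
    rw [he.expOp_apply_basis hA hlam (le_of_lt hs), smul_smul, neg_mul]
  rw [negFracPow, h1, integral_smul_const, Real.integral_rpow_mul_exp_neg_mul_Ioi hα (hlam k),
    smul_smul]
  congr 1
  rw [Real.rpow_neg (hlam k).le, one_div, Real.inv_rpow (hlam k).le]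
  have := (Real.Gamma_pos_of_pos hα).ne'
  field_simp

/-- The eigenvalues of a trace class negative power of `A` are summable, with a bound that does
not depend on the eigenbasis. -/
lemma exists_sum_rpow_le {α : ℝ} (hα : 0 < α) (hA : IsSelfAdjoint A)
    (hneg : ∀ y : A.domain, (y : H) ≠ 0 → ⟪A y, (y : H)⟫ < 0)
    (htr : IsTraceClass (negFracPow A α)) : ∃ L : ℝ, 0 < L ∧
      ∀ (ι : Type*) (e : HilbertBasis ι ℝ H) (lam : ι → ℝ), IsEigenbasis A e lam →
        ∀ F : Finset ι, ∑ k ∈ F, lam k ^ (-α) ≤ L := by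
  obtain ⟨a, b, hab, hR⟩ := htr
  refine ⟨∑' n, ‖a n‖ * ‖b n‖ + 1, by positivity, fun ι e lam he F ↦ ?_⟩
  have hlam := he.lam_pos hneg
  have h1 : ∀ k, HasSum (fun n ↦ ⟪a n, e k⟫ * ⟪e k, b n⟫) (lam k ^ (-α)) := by
    intro k
    have := (hR (e k)).mapL (innerSL ℝ (e k))
    rw [he.negFracPow_apply_basis hA hlam hα] at this
    simpa [real_inner_smul_right, e.orthonormal.1 k] using this
  have h2 := hasSum_sum (s := F) (fun k _ ↦ h1 k)
  have h3 : ∀ n, ∑ k ∈ F, ⟪a n, e k⟫ * ⟪e k, b n⟫ ≤ ‖a n‖ * ‖b n‖ := by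
    intro n
    -- Cauchy–Schwarz and Bessel give a bound free of the basis.
    refine (Real.sum_mul_le_sqrt_mul_sqrt _ _ _).trans ?_
    have hb : ∀ v : H, √(∑ k ∈ F, ⟪e k, v⟫ ^ 2) ≤ ‖v‖ := by
      intro v
      refine Real.sqrt_le_iff.2 ⟨norm_nonneg _, ?_⟩
      exact sum_le_hasSum _ (fun _ _ ↦ sq_nonneg _) (HilbertBasis.hasSum_inner_sq e v)
    simp_rw [real_inner_comm _ (a n)]
    gcongr
    · exact hb _
    · exact hb _
  have := hasSum_le h3 h2 hab.hasSum
  linarith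

end Semigroup

/-! ### Hölder continuity from dyadic increments. -/

section Chaining

lemma natFloor_two_pow_succ_mul (n : ℕ) {t : ℝ} (ht : 0 ≤ t) :
    ⌊2 ^ (n + 1) * t⌋₊ = 2 * ⌊2 ^ n * t⌋₊ ∨ ⌊2 ^ (n + 1) * t⌋₊ = 2 * ⌊2 ^ n * t⌋₊ + 1 := by
  have h1 := Nat.floor_le (show 0 ≤ 2 ^ n * t by positivity)
  have h2 := Nat.lt_floor_add_one (2 ^ n * t)
  have h3 : 2 * ⌊2 ^ n * t⌋₊ ≤ ⌊2 ^ (n + 1) * t⌋₊ := by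
    apply Nat.le_floor
    push_cast
    rw [pow_succ]; linarith
  have h4 : ⌊2 ^ (n + 1) * t⌋₊ < 2 * ⌊2 ^ n * t⌋₊ + 2 := by
    rw [Nat.floor_lt (by positivity)]
    push_cast
    rw [pow_succ]; linarith
  omega

lemma tendsto_natFloor_two_pow_mul_div {t : ℝ} (ht : 0 ≤ t) :
    Tendsto (fun n : ℕ ↦ (⌊2 ^ n * t⌋₊ : ℝ) / 2 ^ n) atTop (𝓝 t) := by
  have h := (tendsto_nat_floor_mul_div_atTop ht).comp
    (tendsto_pow_atTop_atTop_of_one_lt (one_lt_two (α := ℝ)))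
  refine h.congr fun n ↦ ?_
  simp [mul_comm]

/-- A continuous function on `[0,1]` whose increments over dyadic intervals of length `2⁻ⁿ` are at
most `D rⁿ` oscillates by at most a multiple of `D rⁿ` over intervals of length `2⁻ⁿ`. -/
lemma abs_sub_le_of_dyadic_increments {φ : ℝ → ℝ} (hφ : ContinuousOn φ (Set.Icc 0 1)) {D r : ℝ}
    (hD : 0 ≤ D) (hr0 : 0 < r) (hr1 : r < 1)
    (h : ∀ n i : ℕ, i < 2 ^ n → |φ ((i + 1 : ℝ) / 2 ^ n) - φ ((i : ℝ) / 2 ^ n)| ≤ D * r ^ n)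
    {s t : ℝ} (hs : s ∈ Set.Icc (0 : ℝ) 1) (ht : t ∈ Set.Icc (0 : ℝ) 1) (hst : s ≤ t) {n : ℕ}
    (hn : t - s ≤ (1 / 2) ^ n) :
    |φ t - φ s| ≤ (1 + 2 / (1 - r)) * (D * r ^ n) := by
  have hle : ∀ {t : ℝ}, t ∈ Set.Icc (0 : ℝ) 1 → ∀ n : ℕ, ⌊2 ^ n * t⌋₊ ≤ 2 ^ n := by
    intro t ht n
    apply Nat.floor_le_of_le
    push_cast
    exact mul_le_of_le_one_right (by positivity) ht.2
  have hpt : ∀ {t : ℝ}, t ∈ Set.Icc (0 : ℝ) 1 → ∀ n : ℕ,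
      |φ ((⌊2 ^ n * t⌋₊ : ℝ) / 2 ^ n) - φ t| ≤ D * r ^ n / (1 - r) := by
    intro t ht n
    have hmem : ∀ n : ℕ, (⌊2 ^ n * t⌋₊ : ℝ) / 2 ^ n ∈ Set.Icc (0 : ℝ) 1 := by
      intro n
      refine ⟨by positivity, div_le_one_of_le₀ ?_ (by positivity)⟩
      exact_mod_cast hle ht n
    have hlim : Tendsto (fun n : ℕ ↦ φ ((⌊2 ^ n * t⌋₊ : ℝ) / 2 ^ n)) atTop (𝓝 (φ t)) := by
      refine (hφ t ht).tendsto.comp ?_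
      exact tendsto_nhdsWithin_iff.2 ⟨tendsto_natFloor_two_pow_mul_div ht.1, .of_forall hmem⟩
    rw [← Real.dist_eq]
    -- Consecutive dyadic approximations of `t` coincide or are neighbours at the finer level, so
    -- the errors form a geometric series.
    refine dist_le_of_le_geometric_of_tendsto r D hr1 (fun m ↦ ?_) hlim n
    rw [Real.dist_eq, abs_sub_comm]
    rcases natFloor_two_pow_succ_mul m ht.1 with h2 | h2
    · have : (⌊2 ^ (m + 1) * t⌋₊ : ℝ) / 2 ^ (m + 1) = (⌊2 ^ m * t⌋₊ : ℝ) / 2 ^ m := by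
        rw [h2]; push_cast; rw [pow_succ]; field_simp
      rw [this, sub_self, abs_zero]
      positivity
    · have h3 : (⌊2 ^ m * t⌋₊ : ℝ) / 2 ^ m = ((2 * ⌊2 ^ m * t⌋₊ : ℕ) : ℝ) / 2 ^ (m + 1) := by
        push_cast; rw [pow_succ]; field_simp
      have h4 := h (m + 1) (2 * ⌊2 ^ m * t⌋₊) (by have := hle ht (m + 1); omega)
      rw [← h3] at h4
      have h5 : (⌊2 ^ (m + 1) * t⌋₊ : ℝ) = ((2 * ⌊2 ^ m * t⌋₊ : ℕ) : ℝ) + 1 := by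
        rw [h2]; push_cast; ring
      rw [h5]
      refine h4.trans ?_
      gcongr D * ?_
      exact pow_le_pow_of_le_one hr0.le hr1.le (Nat.le_succ m)
  have hmid : |φ ((⌊2 ^ n * t⌋₊ : ℝ) / 2 ^ n) - φ ((⌊2 ^ n * s⌋₊ : ℝ) / 2 ^ n)| ≤ D * r ^ n := by
    have h1 : ⌊2 ^ n * s⌋₊ ≤ ⌊2 ^ n * t⌋₊ := Nat.floor_mono (by gcongr)
    have h2 : ⌊2 ^ n * t⌋₊ < ⌊2 ^ n * s⌋₊ + 2 := by
      rw [Nat.floor_lt (by have := ht.1; positivity)]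
      have h3 := Nat.lt_floor_add_one (2 ^ n * s)
      have h4 : (2 : ℝ) ^ n * (t - s) ≤ 1 := by
        calc (2 : ℝ) ^ n * (t - s) ≤ 2 ^ n * (1 / 2) ^ n := by gcongr
          _ = 1 := by rw [← mul_pow]; norm_num
      push_cast
      linarith
    rcases Nat.lt_or_ge ⌊2 ^ n * s⌋₊ ⌊2 ^ n * t⌋₊ with h3 | h3
    · have h4 : ⌊2 ^ n * t⌋₊ = ⌊2 ^ n * s⌋₊ + 1 := by omega
      rw [h4]
      push_cast
      exact h n _ (by have := hle ht n; omega)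
    · rw [le_antisymm h3 h1, sub_self, abs_zero]
      positivity
  have h1 := hpt ht n
  have h2 := hpt hs n
  rw [abs_sub_comm] at h1
  calc |φ t - φ s| ≤ D * r ^ n / (1 - r) + D * r ^ n + D * r ^ n / (1 - r) := by
        rw [abs_le] at *
        constructor <;> linarith [h1.1, h1.2, h2.1, h2.2, hmid.1, hmid.2]
    _ = _ := by ring

lemma abs_sub_le_rpow_of_dyadic_increments {φ : ℝ → ℝ} (hφ : ContinuousOn φ (Set.Icc 0 1))
    {D γ : ℝ} (hD : 0 ≤ D) (hγ : 0 < γ)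
    (h : ∀ n i : ℕ, i < 2 ^ n →
      |φ ((i + 1 : ℝ) / 2 ^ n) - φ ((i : ℝ) / 2 ^ n)| ≤ D * ((1 / 2 : ℝ) ^ γ) ^ n)
    {s t : ℝ} (hs : s ∈ Set.Icc (0 : ℝ) 1) (ht : t ∈ Set.Icc (0 : ℝ) 1) :
    |φ t - φ s| ≤ (1 + 2 / (1 - (1 / 2 : ℝ) ^ γ)) / (1 / 2 : ℝ) ^ γ * D * |t - s| ^ γ := by
  wlog hst : s ≤ t generalizing s t
  · rw [abs_sub_comm, abs_sub_comm t]
    exact this ht hs (not_le.1 hst).le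
  have hr0 : (0 : ℝ) < (1 / 2 : ℝ) ^ γ := by positivity
  have hr1 : (1 / 2 : ℝ) ^ γ < 1 := Real.rpow_lt_one (by norm_num) (by norm_num) hγ
  have hr2 : 0 < 1 - (1 / 2 : ℝ) ^ γ := by linarith
  rcases hst.eq_or_lt with rfl | hlt
  · simp only [sub_self, abs_zero]
    positivity
  -- The level satisfies `(1/2)^(n+1) < t - s ≤ (1/2)^n`; the gap of one level costs the divisor
  -- `(1/2)^γ`.
  obtain ⟨n, hn1, hn2⟩ := exists_nat_pow_near_of_lt_one (x := t - s) (y := (1 / 2 : ℝ))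
    (by linarith) (by linarith [hs.1, ht.2]) (by norm_num) (by norm_num)
  refine (abs_sub_le_of_dyadic_increments hφ hD hr0 hr1 h hs ht hst hn2).trans ?_
  have h3 : ((1 / 2 : ℝ) ^ γ) ^ n * (1 / 2 : ℝ) ^ γ ≤ |t - s| ^ γ := by
    rw [← pow_succ, ← Real.rpow_mul_natCast (by norm_num), mul_comm γ, Real.rpow_natCast_mul (by norm_num),
      abs_of_pos (by linarith)]
    exact Real.rpow_le_rpow (by positivity) hn1.le hγ.le
  calc _ = (1 + 2 / (1 - (1 / 2 : ℝ) ^ γ)) / (1 / 2 : ℝ) ^ γ * D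
        * (((1 / 2 : ℝ) ^ γ) ^ n * (1 / 2 : ℝ) ^ γ) := by field_simp
    _ ≤ _ := by gcongr

end Chaining

/-! ### Summation by parts for left-point sums. -/

section LeftSums

/-- Summation by parts produces `(g (i+1) - g i) (g (i+1) + g i) c (i+1)`. One factor `g` tames `c`,
and the differences of the other telescope; hence the weight is written as a square. -/
lemma abs_sum_sq_mul_sub_le {g c : ℕ → ℝ} {K : ℝ} (hg : Monotone g) (hg0 : ∀ i, 0 ≤ g i)
    (hK : ∀ i, g i * |c i| ≤ K) (m : ℕ) :
    |∑ i ∈ Finset.range m, g i ^ 2 * (c i - c (i + 1)) + g m ^ 2 * c m| ≤ 2 * K * g m := by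
  induction m with
  | zero =>
    simp only [Finset.range_zero, Finset.sum_empty, zero_add, abs_mul, abs_pow, abs_of_nonneg (hg0 0)]
    nlinarith [hK 0, hg0 0, mul_nonneg (hg0 0) (abs_nonneg (c 0)),
      mul_le_mul_of_nonneg_left (hK 0) (hg0 0)]
  | succ m ih =>
    have h1 : ∑ i ∈ Finset.range (m + 1), g i ^ 2 * (c i - c (i + 1)) + g (m + 1) ^ 2 * c (m + 1)
        = (∑ i ∈ Finset.range m, g i ^ 2 * (c i - c (i + 1)) + g m ^ 2 * c m)
          + (g (m + 1) - g m) * ((g (m + 1) + g m) * c (m + 1)) := by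
      rw [Finset.sum_range_succ]; ring
    have h2 := hg (Nat.le_succ m)
    have h3 : |(g (m + 1) - g m) * ((g (m + 1) + g m) * c (m + 1))|
        ≤ (g (m + 1) - g m) * (2 * K) := by
      rw [abs_mul, abs_of_nonneg (sub_nonneg.2 h2), abs_mul,
        abs_of_nonneg (add_nonneg (hg0 _) (hg0 _))]
      refine mul_le_mul_of_nonneg_left ?_ (sub_nonneg.2 h2)
      have := mul_le_mul_of_nonneg_right h2 (abs_nonneg (c (m + 1)))
      have := hK (m + 1)
      nlinarith
    rw [h1]
    refine (abs_add_le _ _).trans ?_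
    linarith

/-- With `x = l (t - s)` this trades the Hölder modulus `(t - s)^γ` for `l ^ (-γ)`, at the price of
half of the exponential weight. -/
lemma rpow_le_two_mul_exp_half {x γ : ℝ} (hx : 0 ≤ x) (hγ0 : 0 ≤ γ) (hγ1 : γ ≤ 1) :
    x ^ γ ≤ 2 * Real.exp (x / 2) := by
  have h1 : x ^ γ ≤ 1 + x := by
    rcases le_total x 1 with h | h
    · linarith [Real.rpow_le_one hx h hγ0]
    · have := Real.rpow_le_rpow_of_exponent_le h hγ1
      rw [Real.rpow_one] at this
      linarith
  linarith [Real.add_one_le_exp (x / 2)]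

/-- The left-point sums of `∫_0^t e^{-l(t-s)} db_s` are controlled by the Hölder constant of `b`,
with the decay in `l` that the Hölder exponent dictates. -/
lemma abs_leftSum_exp_le {b : ℝ≥0 → ℝ} {Q γ l : ℝ} (hQ : 0 ≤ Q) (hγ0 : 0 ≤ γ) (hγ1 : γ ≤ 1)
    (hl : 0 < l) {t : ℝ≥0} (hb : ∀ s ≤ t, |b t - b s| ≤ Q * ((t : ℝ) - s) ^ γ) (n : ℕ) :
    |∑ i ∈ Finset.range n, Real.exp (-l * (t - (i : ℝ) * t / n)) *
        (b (((i : ℝ≥0) + 1) * t / n) - b ((i : ℝ≥0) * t / n))| ≤ 4 * Q * l ^ (-γ) := by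
  rcases Nat.eq_zero_or_pos n with rfl | hn
  · simp only [Finset.range_zero, Finset.sum_empty, abs_zero]
    positivity
  have hn' : (0 : ℝ) < n := by exact_mod_cast hn
  -- Truncating at `t` keeps the bounds valid for every index, including those beyond `n`.
  set s : ℕ → ℝ≥0 := fun i ↦ min ((i : ℝ≥0) * t / n) t with hs
  set g : ℕ → ℝ := fun i ↦ Real.exp (-(l * ((t : ℝ) - s i) / 2)) with hg
  set c : ℕ → ℝ := fun i ↦ b t - b (s i) with hc
  have hsle : ∀ i ≤ n, s i = (i : ℝ≥0) * t / n := by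
    intro i hi
    refine min_eq_left ?_
    have : (i : ℝ≥0) ≤ n := by exact_mod_cast hi
    have hn2 : (0 : ℝ≥0) < n := by exact_mod_cast hn
    rw [div_le_iff₀ hn2, mul_comm t]
    gcongr
  have hmono : Monotone s := by
    intro i j hij
    simp only [hs]
    gcongr
  have hst : ∀ i, s i ≤ t := fun i ↦ min_le_right _ _
  have hgm : Monotone g := by
    intro i j hij
    simp only [hg]
    have : (s i : ℝ) ≤ s j := hmono hij
    gcongr
  have hK : ∀ i, g i * |c i| ≤ 2 * Q * l ^ (-γ) := by
    intro i
    have h0 : (0 : ℝ) ≤ t - s i := sub_nonneg.2 (hst i)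
    have h1 := hb (s i) (hst i)
    have h2 := rpow_le_two_mul_exp_half (mul_nonneg hl.le h0) hγ0 hγ1
    rw [Real.mul_rpow hl.le h0] at h2
    have h3 : l ^ (-γ) * l ^ γ = 1 := by rw [← Real.rpow_add hl]; simp
    have h4 : ((t : ℝ) - s i) ^ γ ≤ l ^ (-γ) * (2 * Real.exp (l * (t - s i) / 2)) := by
      calc ((t : ℝ) - s i) ^ γ = l ^ (-γ) * (l ^ γ * ((t : ℝ) - s i) ^ γ) := by
            rw [← mul_assoc, h3, one_mul]
        _ ≤ _ := by gcongr
    have h5 : g i * Real.exp (l * (t - s i) / 2) = 1 := by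
      rw [hg, ← Real.exp_add]; simp
    calc g i * |c i| ≤ g i * (Q * (l ^ (-γ) * (2 * Real.exp (l * (t - s i) / 2)))) := by
          have : 0 ≤ g i := (Real.exp_pos _).le
          gcongr
          exact h1.trans (by gcongr)
      _ = 2 * Q * l ^ (-γ) * (g i * Real.exp (l * (t - s i) / 2)) := by ring
      _ = _ := by rw [h5, mul_one]
  have hsn : s n = t := by
    rw [hsle n le_rfl]
    have : (n : ℝ≥0) ≠ 0 := by exact_mod_cast hn.ne'
    field_simp
  have key := abs_sum_sq_mul_sub_le hgm (fun i ↦ (Real.exp_pos _).le) hK n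
  have hcn : c n = 0 := by simp [hc, hsn]
  have hgn : g n = 1 := by simp [hg, hsn]
  rw [hcn, hgn, mul_zero, add_zero, mul_one] at key
  refine le_trans (le_of_eq ?_) (key.trans (le_of_eq (by ring)))
  congr 1
  refine Finset.sum_congr rfl fun i hi ↦ ?_
  have hi := Finset.mem_range.1 hi
  have e1 : ((i + 1 : ℕ) : ℝ≥0) = (i : ℝ≥0) + 1 := by push_cast; rfl
  have e2 : (s i : ℝ) = (i : ℝ) * t / n := by rw [hsle i hi.le]; push_cast; rfl
  simp only [hg, hc]
  rw [hsle (i + 1) hi, e1, e2, ← hsle i hi.le, ← Real.exp_nat_mul]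
  congr 1
  · congr 1; push_cast; ring
  · ring

end LeftSums

/-! ### Hölder constants controlled by exponential sums. -/

section DyadicIncrements

/-- The increment of `b` over the `i`-th dyadic subinterval of level `n` of `[0,T]`, divided by the
square root of the length. -/
noncomputable def dyadicIncrement (T : ℝ≥0) (n i : ℕ) (b : ℝ≥0 → ℝ) : ℝ :=
  (b (((i : ℝ≥0) + 1) * T / 2 ^ n) - b ((i : ℝ≥0) * T / 2 ^ n)) / √(T / 2 ^ n)

/-- `∑_n 4⁻ⁿ ∑_{i < 2ⁿ} exp (c ξ_{n,i}²)`, with `ξ` the normalised dyadic increments of `b`. -/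
noncomputable def dyadicExpSum (c : ℝ) (T : ℝ≥0) (b : ℝ≥0 → ℝ) : ℝ≥0∞ :=
  ∑' n : ℕ, ∑ i ∈ Finset.range (2 ^ n),
    ENNReal.ofReal ((1 / 4) ^ n * Real.exp (c * dyadicIncrement T n i b ^ 2))

lemma dyadicExpSum_term_le (c : ℝ) (T : ℝ≥0) (b : ℝ≥0 → ℝ) {n i : ℕ} (hi : i < 2 ^ n) :
    ENNReal.ofReal ((1 / 4) ^ n * Real.exp (c * dyadicIncrement T n i b ^ 2))
      ≤ dyadicExpSum c T b :=
  (Finset.single_le_sum (f := fun i ↦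
    ENNReal.ofReal ((1 / 4) ^ n * Real.exp (c * dyadicIncrement T n i b ^ 2)))
    (fun _ _ ↦ zero_le) (Finset.mem_range.2 hi)).trans (ENNReal.le_tsum n)

lemma one_le_dyadicExpSum {c : ℝ} (hc : 0 ≤ c) (T : ℝ≥0) (b : ℝ≥0 → ℝ) :
    1 ≤ dyadicExpSum c T b := by
  refine le_trans ?_ (dyadicExpSum_term_le c T b (n := 0) (i := 0) (by norm_num))
  rw [← ENNReal.ofReal_one]
  apply ENNReal.ofReal_le_ofReal
  simpa using mul_nonneg hc (sq_nonneg _)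

/-- A continuous path with finite `dyadicExpSum` is Hölder continuous on `[0,T]`, with a constant
that is explicit in `T` and in the logarithm of the sum. -/
lemma exists_holder_of_dyadicExpSum {c γ : ℝ} (hc : 0 < c) (hγ0 : 0 < γ) (hγ1 : 2 * γ < 1) :
    ∃ K : ℝ, 0 < K ∧ ∀ (T : ℝ≥0), 0 < T → ∀ b : ℝ≥0 → ℝ, Continuous b →
      dyadicExpSum c T b ≠ ∞ → ∀ s ≤ T, ∀ t ≤ T,
        |b t - b s| ≤ √(K * (T : ℝ) ^ (1 - 2 * γ) * (1 + Real.log (dyadicExpSum c T b).toReal))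
          * |(t : ℝ) - s| ^ γ := by
  have hρ0 : (0 : ℝ) < (1 / 2 : ℝ) ^ (1 - 2 * γ) := by positivity
  have hρ1 : (1 / 2 : ℝ) ^ (1 - 2 * γ) < 1 :=
    Real.rpow_lt_one (by norm_num) (by norm_num) (by linarith)
  -- Because `2γ < 1`, the linear growth `2n + 1` coming from the logarithms is beaten by the spare
  -- geometric factor.
  obtain ⟨K0, hK0⟩ := (((tendsto_self_mul_const_pow_of_lt_one hρ0.le hρ1).const_mul 2).add
    (tendsto_pow_atTop_nhds_zero_of_lt_one hρ0.le hρ1)).bddAbove_range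
  have hK0' : ∀ n : ℕ, (2 * n + 1) * ((1 / 2 : ℝ) ^ (1 - 2 * γ)) ^ n ≤ K0 := by
    intro n
    have := hK0 ⟨n, rfl⟩
    simp only at this
    linarith
  have hK0pos : 0 < K0 := lt_of_lt_of_le (by norm_num) (hK0' 0)
  set c2 : ℝ := (1 + 2 / (1 - (1 / 2 : ℝ) ^ γ)) / (1 / 2 : ℝ) ^ γ with hc2
  have hr1 : (1 / 2 : ℝ) ^ γ < 1 := Real.rpow_lt_one (by norm_num) (by norm_num) hγ0
  have hc2pos : 0 < c2 := by
    have : 0 < 1 - (1 / 2 : ℝ) ^ γ := by linarith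
    positivity
  refine ⟨c2 ^ 2 * (K0 / c), by positivity, fun T hT b hb hfin s hs t ht ↦ ?_⟩
  set g := (dyadicExpSum c T b).toReal with hg
  have hg1 : 1 ≤ g := by
    have := ENNReal.toReal_mono hfin (one_le_dyadicExpSum hc.le T b)
    simpa using this
  have hlog : 0 ≤ Real.log g := Real.log_nonneg hg1
  have hT' : (0 : ℝ) < T := hT
  set D : ℝ := √(T * (1 + Real.log g) * (K0 / c)) with hD
  -- Each term is at most the whole sum; taking logarithms, the weight `4⁻ⁿ` costs at most `2n`.
  have hxi : ∀ n i : ℕ, i < 2 ^ n → c * dyadicIncrement T n i b ^ 2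
      ≤ (2 * n + 1) * (1 + Real.log g) := by
    intro n i hi
    have h1 := ENNReal.toReal_mono hfin (dyadicExpSum_term_le c T b hi)
    rw [ENNReal.toReal_ofReal (by positivity), ← hg] at h1
    have h2 := Real.log_le_log (by positivity) h1
    rw [Real.log_mul (by positivity) (by positivity), Real.log_exp, Real.log_pow] at h2
    have h3 : -2 ≤ Real.log (1 / 4) := by
      have : Real.log (1 / 4) = -(2 * Real.log 2) := by
        rw [one_div, Real.log_inv, show (4 : ℝ) = 2 ^ 2 by norm_num, Real.log_pow]; push_cast; ring
      rw [this]
      linarith [Real.log_two_lt_d9]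
    have h4 : (n : ℝ) * (-2) ≤ n * Real.log (1 / 4) := by gcongr
    have h5 : 0 ≤ (n : ℝ) * Real.log g := by positivity
    nlinarith
  have hinc : ∀ n i : ℕ, i < 2 ^ n →
      |b (((i : ℝ≥0) + 1) * T / 2 ^ n) - b ((i : ℝ≥0) * T / 2 ^ n)| ≤ D * ((1 / 2 : ℝ) ^ γ) ^ n := by
    intro n i hi
    apply abs_le_of_sq_le_sq _ (by positivity)
    have h1 := hxi n i hi
    rw [dyadicIncrement, div_pow, Real.sq_sqrt (by positivity)] at h1
    have h2 : (((1 / 2 : ℝ) ^ γ) ^ n) ^ 2 * ((1 / 2 : ℝ) ^ (1 - 2 * γ)) ^ n = 1 / 2 ^ n := by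
      rw [← pow_mul, mul_comm n 2, pow_mul, ← mul_pow, ← Real.rpow_mul_natCast (by norm_num),
        ← Real.rpow_add (by norm_num)]
      have : γ * (2 : ℕ) + (1 - 2 * γ) = 1 := by push_cast; ring
      rw [this, Real.rpow_one, div_pow, one_pow]
    rw [mul_pow, hD, Real.sq_sqrt (by positivity)]
    set d := b (((i : ℝ≥0) + 1) * T / 2 ^ n) - b ((i : ℝ≥0) * T / 2 ^ n)
    calc d ^ 2 = c * (d ^ 2 / (T / 2 ^ n)) * (T * (1 / 2 ^ n) / c) := by field_simp
      _ ≤ (2 * n + 1) * (1 + Real.log g) * (T * (1 / 2 ^ n) / c) := by gcongr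
      _ = T * (1 + Real.log g) * (((2 * n + 1) * ((1 / 2 : ℝ) ^ (1 - 2 * γ)) ^ n) / c) *
            (((1 / 2 : ℝ) ^ γ) ^ n) ^ 2 := by rw [← h2]; field_simp
      _ ≤ T * (1 + Real.log g) * (K0 / c) * (((1 / 2 : ℝ) ^ γ) ^ n) ^ 2 := by
          gcongr
          exact hK0' n
  have hres := abs_sub_le_rpow_of_dyadic_increments (φ := fun u ↦ b (u.toNNReal * T)) (D := D)
    (γ := γ) (by fun_prop) (by positivity) hγ0
    (fun n i hi ↦ by
      convert hinc n i hi using 5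
      · rw [Real.toNNReal_div (by positivity), Real.toNNReal_pow (by norm_num),
          Real.toNNReal_add (by positivity) (by norm_num)]
        simp
        ring
      · rw [Real.toNNReal_div (by positivity), Real.toNNReal_pow (by norm_num)]
        simp
        ring)
    (s := s / T) (t := t / T) ⟨by positivity, div_le_one_of_le₀ hs T.2⟩
    ⟨by positivity, div_le_one_of_le₀ ht T.2⟩
  have hback : ∀ u : ℝ≥0, ((u : ℝ) / T).toNNReal * T = u := by
    intro u
    rw [← NNReal.coe_div, Real.toNNReal_coe, div_mul_cancel₀ _ hT.ne']
  simp only [hback] at hres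
  refine hres.trans (le_of_eq ?_)
  rw [← sub_div, abs_div, abs_of_pos hT', Real.div_rpow (abs_nonneg _) hT'.le, ← hc2]
  have h1 : √(c2 ^ 2 * (K0 / c) * (T : ℝ) ^ (1 - 2 * γ) * (1 + Real.log g)) = c2 * D / T ^ γ := by
    rw [Real.sqrt_eq_iff_mul_self_eq (by positivity) (by positivity), hD]
    have h2 : (T : ℝ) ^ (1 - 2 * γ) = T / (T ^ γ * T ^ γ) := by
      rw [Real.rpow_sub hT', two_mul, Real.rpow_add hT', Real.rpow_one]
    rw [h2]
    have h3 := Real.mul_self_sqrt (show 0 ≤ (T : ℝ) * (1 + Real.log g) * (K0 / c) by positivity)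
    field_simp at h3 ⊢
    nlinarith [h3]
  rw [h1]
  ring

end DyadicIncrements

/-! ### Expectation of the exponential sums for Brownian motion. -/

section BrownianMotion

variable {Ω : Type*} {mΩ : MeasurableSpace Ω} {P : Measure Ω}

lemma hasLaw_dyadicIncrement {b : ℝ≥0 → Ω → ℝ} (hb : IsPreBrownianReal b P) {T : ℝ≥0} (hT : 0 < T)
    (n i : ℕ) : HasLaw (fun ω ↦ dyadicIncrement T n i (fun t ↦ b t ω)) (gaussianReal 0 1) P := by
  have h := hb.hasLaw_sub (((i : ℝ≥0) + 1) * T / 2 ^ n) ((i : ℝ≥0) * T / 2 ^ n)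
  have h2 := HasLaw.comp (Y := fun x ↦ x / √(T / 2 ^ n)) ⟨by fun_prop, gaussianReal_map_div_const _⟩ h
  have hT' : (0 : ℝ) < T := hT
  have hd : dist (((i : ℝ) + 1) * T / 2 ^ n) ((i : ℝ) * T / 2 ^ n) = T / 2 ^ n := by
    rw [Real.dist_eq, abs_of_nonneg] <;> ring_nf
    positivity
  refine (?_ : gaussianReal _ _ = gaussianReal 0 1) ▸ h2
  rw [zero_div]
  congr 1
  ext
  rw [NNReal.coe_div, NNReal.coe_mk, Real.sq_sqrt (by positivity), coe_nndist]
  change dist (((i : ℝ) + 1) * T / 2 ^ n) ((i : ℝ) * T / 2 ^ n) / _ = _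
  rw [hd, NNReal.coe_one]
  exact div_self (by positivity)

lemma aemeasurable_dyadicExpSum {b : ℝ≥0 → Ω → ℝ} (hb : IsPreBrownianReal b P) (c : ℝ) (T : ℝ≥0) :
    AEMeasurable (fun ω ↦ dyadicExpSum c T (fun t ↦ b t ω)) P := by
  have := hb.aemeasurable
  unfold dyadicExpSum dyadicIncrement
  fun_prop

/-- Normalised increments are standard Gaussian, and level `n` has `2ⁿ` terms of weight `4⁻ⁿ`,
leaving `∑ 2⁻ⁿ = 2`. The value does not depend on `T`. -/
lemma lintegral_dyadicExpSum {b : ℝ≥0 → Ω → ℝ} (hb : IsPreBrownianReal b P) (c : ℝ) {T : ℝ≥0}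
    (hT : 0 < T) : ∫⁻ ω, dyadicExpSum c T (fun t ↦ b t ω) ∂P
      = 2 * ∫⁻ x, ENNReal.ofReal (Real.exp (c * x ^ 2)) ∂gaussianReal 0 1 := by
  have hm := hb.aemeasurable
  have hm2 : ∀ n i, AEMeasurable (fun ω ↦ ENNReal.ofReal ((1 / 4) ^ n *
      Real.exp (c * dyadicIncrement T n i (fun t ↦ b t ω) ^ 2))) P := by
    intro n i
    unfold dyadicIncrement
    fun_prop
  set κ := ∫⁻ x, ENNReal.ofReal (Real.exp (c * x ^ 2)) ∂gaussianReal 0 1 with hκ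
  have h1 : ∀ n i, ∫⁻ ω, ENNReal.ofReal ((1 / 4) ^ n *
      Real.exp (c * dyadicIncrement T n i (fun t ↦ b t ω) ^ 2)) ∂P = (1 / 4) ^ n * κ := by
    intro n i
    rw [hκ, ← (hasLaw_dyadicIncrement hb hT n i).lintegral_comp (by fun_prop),
      ← lintegral_const_mul' _ _ (by simp)]
    refine lintegral_congr fun ω ↦ ?_
    rw [ENNReal.ofReal_mul (by positivity), ENNReal.ofReal_pow (by norm_num),
      ENNReal.ofReal_div_of_pos (by norm_num)]
    simp
  unfold dyadicExpSum
  rw [lintegral_tsum (fun n ↦ Finset.aemeasurable_fun_sum _ fun i _ ↦ hm2 n i)]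
  have h2 : ∀ n : ℕ, ∫⁻ ω, ∑ i ∈ Finset.range (2 ^ n), ENNReal.ofReal ((1 / 4) ^ n *
      Real.exp (c * dyadicIncrement T n i (fun t ↦ b t ω) ^ 2)) ∂P = 2⁻¹ ^ n * κ := by
    intro n
    rw [lintegral_finsetSum' _ fun i _ ↦ hm2 n i]
    simp only [h1, Finset.sum_const, Finset.card_range, nsmul_eq_mul, ← mul_assoc]
    congr 1
    push_cast
    rw [← mul_pow]
    congr 1
    rw [one_div, show (4 : ℝ≥0∞) = 2 * 2 by norm_num, ENNReal.mul_inv (by simp) (by simp), ← mul_assoc,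
      ENNReal.mul_inv_cancel (by simp) (by simp), one_mul]
  simp_rw [h2]
  rw [ENNReal.tsum_mul_right, ENNReal.tsum_geometric, ENNReal.one_sub_inv_two, inv_inv]

end BrownianMotion

/-! ### Passing bounds to limits in probability and to all times. -/

section Limits

variable {Ω : Type*} {mΩ : MeasurableSpace Ω} {P : Measure Ω}

lemma ae_abs_le_of_tendstoInMeasure {f : ℕ → Ω → ℝ} {I R : Ω → ℝ}
    (h : TendstoInMeasure P f atTop I) (hR : ∀ᵐ ω ∂P, ∀ n, |f n ω| ≤ R ω) :
    ∀ᵐ ω ∂P, |I ω| ≤ R ω := by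
  obtain ⟨ns, -, hns⟩ := h.exists_seq_tendsto_ae
  filter_upwards [hns, hR] with ω h1 h2
  exact le_of_tendsto h1.abs (.of_forall fun n ↦ h2 _)

lemma forall_le_of_forall_denseSeq {F : ℝ≥0 → ℝ} (hF : Continuous F) {T : ℝ≥0} {M : ℝ}
    (h : ∀ n, F (min (TopologicalSpace.denseSeq ℝ≥0 n) T) ≤ M) : ∀ t ≤ T, F t ≤ M := by
  intro t ht
  have hc : IsClosed {s : ℝ≥0 | F (min s T) ≤ M} :=
    isClosed_le (by fun_prop) continuous_const
  have := (TopologicalSpace.denseRange_denseSeq ℝ≥0).induction_on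
    (p := fun s ↦ F (min s T) ≤ M) t hc h
  rwa [min_eq_left ht] at this

end Limits

/-! ### The supremum of the stochastic convolution. -/

section StochasticConvolution

variable {Ω : Type*} {mΩ : MeasurableSpace Ω} {P : Measure Ω}
  {H : Type*} [NormedAddCommGroup H] [InnerProductSpace ℝ H] {ι : Type*}

lemma IsWienerIntegral.ae_abs_le_of_holder {b : ℝ≥0 → Ω → ℝ} {l γ : ℝ} (hl : 0 < l) (hγ0 : 0 ≤ γ)
    (hγ1 : γ ≤ 1) {t : ℝ≥0} {I Q : Ω → ℝ}
    (h : IsWienerIntegral P b (fun s ↦ Real.exp (-l * (t - s))) t I) (hQ0 : ∀ ω, 0 ≤ Q ω)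
    (hQ : ∀ᵐ ω ∂P, ∀ s ≤ t, |b t ω - b s ω| ≤ Q ω * ((t : ℝ) - s) ^ γ) :
    ∀ᵐ ω ∂P, |I ω| ≤ 4 * Q ω * l ^ (-γ) := by
  refine ae_abs_le_of_tendstoInMeasure h ?_
  filter_upwards [hQ] with ω hω n
  exact abs_leftSum_exp_le (b := fun s ↦ b s ω) (hQ0 ω) hγ0 hγ1 hl hω n

lemma IsStochasticConvolution.ae_eq_zero_at_zero [Countable ι] {e : HilbertBasis ι ℝ H}
    {lam : ι → ℝ} {β : ι → ℝ≥0 → Ω → ℝ} {V : ℝ≥0 → Ω → H}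
    (hV : IsStochasticConvolution P e lam β V) : ∀ᵐ ω ∂P, V 0 ω = 0 := by
  have h : ∀ k, ∀ᵐ ω ∂P, |⟪e k, V 0 ω⟫| ≤ 0 := fun k ↦
    ae_abs_le_of_tendstoInMeasure (hV.coord 0 k) (.of_forall fun ω n ↦ by simp)
  filter_upwards [ae_all_iff.2 h] with ω hω
  exact HilbertBasis.ext_inner e fun k ↦ by simpa using hω k

/-- Two continuous versions of the stochastic convolution are indistinguishable. -/
lemma IsStochasticConvolution.ae_eq [Countable ι] {e : HilbertBasis ι ℝ H}
    {lam : ι → ℝ} {β : ι → ℝ≥0 → Ω → ℝ} {V V' : ℝ≥0 → Ω → H}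
    (hV : IsStochasticConvolution P e lam β V) (hV' : IsStochasticConvolution P e lam β V') :
    ∀ᵐ ω ∂P, ∀ t, V t ω = V' t ω := by
  have h : ∀ n k, ∀ᵐ ω ∂P, ⟪e k, V (TopologicalSpace.denseSeq ℝ≥0 n) ω⟫
      = ⟪e k, V' (TopologicalSpace.denseSeq ℝ≥0 n) ω⟫ := fun n k ↦
    tendstoInMeasure_ae_unique (hV.coord _ k) (hV'.coord _ k)
  filter_upwards [ae_all_iff.2 fun n ↦ ae_all_iff.2 (h n), hV.continuous, hV'.continuous]
    with ω h1 h2 h3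
  refine fun t ↦ congrFun (Continuous.ext_on (TopologicalSpace.denseRange_denseSeq ℝ≥0) h2 h3 ?_) t
  rintro _ ⟨n, rfl⟩
  exact HilbertBasis.ext_inner e (h1 n)

/-- This replaces the logarithms of the individual coordinate sums by one common logarithm, plus
ratios whose weighted sum is at most `1`. -/
lemma log_le_log_add_div {x y : ℝ} (hx : 0 < x) (hy : 0 < y) :
    Real.log x ≤ Real.log y + x / y := by
  have := Real.log_le_sub_one_of_pos (div_pos hx hy)
  rw [Real.log_div hx.ne' hy.ne'] at this
  linarith

/-- The supremum over `[0,T]` of the squared norm of a stochastic convolution is at most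
`a T ^ δ (1 + log G)` with `G` of bounded expectation; `a` and the bound depend only on `δ` and
on a bound of the trace `∑ lam k ^ (-(1 - δ))`. -/
theorem exists_sup_stochasticConvolution_le {δ L : ℝ} (hδ0 : 0 < δ) (hδ1 : δ < 1) (hL : 0 < L) :
    ∃ a N : ℝ, 0 < a ∧ 0 < N ∧
      ∀ {H : Type*} [NormedAddCommGroup H] [InnerProductSpace ℝ H] {ι : Type*} [Countable ι]
        (e : HilbertBasis ι ℝ H) (lam : ι → ℝ), (∀ k, 0 < lam k) →
        (∀ F : Finset ι, ∑ k ∈ F, lam k ^ (-(1 - δ)) ≤ L) →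
      ∀ {Ω : Type*} {_ : MeasurableSpace Ω} (P : Measure Ω) [IsProbabilityMeasure P]
        (β : ι → ℝ≥0 → Ω → ℝ), (∀ k, IsBrownianReal (β k) P) →
      ∀ V : ℝ≥0 → Ω → H, IsStochasticConvolution P e lam β V →
      ∀ T : ℝ≥0, 0 < T → ∃ G : Ω → ℝ, AEMeasurable G P ∧ (∀ᵐ ω ∂P, 1 ≤ G ω) ∧
        ∫⁻ ω, ENNReal.ofReal (G ω) ∂P ≤ ENNReal.ofReal N ∧
        ∀ᵐ ω ∂P, ∀ t ≤ T, ‖V t ω‖ ^ 2 ≤ a * (T : ℝ) ^ δ * (1 + Real.log (G ω)) := by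
  obtain ⟨c, hc, hint⟩ := IsGaussian.exists_integrable_exp_sq (gaussianReal 0 1)
  simp only [Real.norm_eq_abs, sq_abs] at hint
  -- With this exponent `lam k ^ (-2γ)` is the summable quantity, `γ < 1/2` is admissible for
  -- Brownian paths, and `T ^ (1 - 2γ) = T ^ δ`.
  set γ : ℝ := (1 - δ) / 2 with hγ
  obtain ⟨K, hK, hhol⟩ := exists_holder_of_dyadicExpSum (c := c) (γ := γ) hc (by linarith)
    (by linarith)
  have hγδ : 1 - 2 * γ = δ := by rw [hγ]; ring
  rw [hγδ] at hhol
  set κ := ∫⁻ x, ENNReal.ofReal (Real.exp (c * x ^ 2)) ∂gaussianReal 0 1 with hκ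
  have hκfin : κ ≠ ∞ := by
    rw [hκ, ← ofReal_integral_eq_lintegral_ofReal hint (.of_forall fun _ ↦ (Real.exp_pos _).le)]
    exact ENNReal.ofReal_ne_top
  refine ⟨16 * K * (L + 1), 1 + L * (2 * κ).toReal, by positivity, by positivity, ?_⟩
  intro H _ _ ι _ e lam hlam hsum Ω _ P _ β hβ V hV T hT
  set D : ι → Ω → ℝ≥0∞ := fun k ω ↦ dyadicExpSum c T (fun t ↦ β k t ω) with hD
  set μ : ι → ℝ := fun k ↦ lam k ^ (-(1 - δ)) with hμ
  have hμ0 : ∀ k, 0 < μ k := fun k ↦ Real.rpow_pos_of_pos (hlam k) _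
  -- Weighting by the trace terms makes the expectation at most `1 + 2 L κ`, and `E` dominates every
  -- weighted `D k`.
  set E : Ω → ℝ≥0∞ := fun ω ↦ 1 + ∑' k, ENNReal.ofReal (μ k) * D k ω with hE
  have hDm : ∀ k, AEMeasurable (D k) P := fun k ↦ aemeasurable_dyadicExpSum (hβ k).1 c T
  have hEm : AEMeasurable E P := by fun_prop
  have hEint : ∫⁻ ω, E ω ∂P ≤ ENNReal.ofReal (1 + L * (2 * κ).toReal) := by
    have h1 : ∑' k, ENNReal.ofReal (μ k) ≤ ENNReal.ofReal L := by
      rw [ENNReal.tsum_eq_iSup_sum]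
      refine iSup_le fun F ↦ ?_
      rw [← ENNReal.ofReal_sum_of_nonneg fun k _ ↦ (hμ0 k).le]
      exact ENNReal.ofReal_le_ofReal (hsum F)
    rw [hE, lintegral_add_left measurable_const, lintegral_tsum fun k ↦ (hDm k).const_mul _]
    simp only [lintegral_one, measure_univ]
    have h2 : ∀ k, ∫⁻ ω, ENNReal.ofReal (μ k) * D k ω ∂P = ENNReal.ofReal (μ k) * (2 * κ) := by
      intro k
      rw [lintegral_const_mul' _ _ ENNReal.ofReal_ne_top, hD, lintegral_dyadicExpSum (hβ k).1 c hT]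
    simp_rw [h2]
    rw [ENNReal.tsum_mul_right, ENNReal.ofReal_add zero_le_one (by positivity), ENNReal.ofReal_one,
      ENNReal.ofReal_mul hL.le, ENNReal.ofReal_toReal (ENNReal.mul_ne_top (by simp) hκfin)]
    gcongr
  have hEfin : ∀ᵐ ω ∂P, E ω < ∞ :=
    ae_lt_top' hEm (hEint.trans_lt ENNReal.ofReal_lt_top).ne
  refine ⟨fun ω ↦ (E ω).toReal, hEm.ennreal_toReal, ?_, ?_, ?_⟩
  · filter_upwards [hEfin] with ω hω
    have : (1 : ℝ≥0∞) ≤ E ω := le_self_add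
    simpa using ENNReal.toReal_mono hω.ne this
  · exact (lintegral_mono fun ω ↦ ENNReal.ofReal_toReal_le).trans hEint
  have hDle : ∀ k ω, ENNReal.ofReal (μ k) * D k ω ≤ E ω := fun k ω ↦
    (ENNReal.le_tsum k).trans le_add_self
  have hDfin : ∀ k ω, E ω < ∞ → D k ω ≠ ∞ := by
    intro k ω hω h
    have := (hDle k ω).trans_lt hω
    rw [h, ENNReal.mul_top (by simpa using hμ0 k)] at this
    exact lt_irrefl _ this
  -- Wiener integrals are determined only almost surely at each fixed time, so a countable dense set
  -- of times is used first; continuity of `V` extends the bound.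
  have hcoord : ∀ n k, ∀ᵐ ω ∂P,
      |⟪e k, V (min (TopologicalSpace.denseSeq ℝ≥0 n) T) ω⟫|
        ≤ 4 * √(K * (T : ℝ) ^ δ * (1 + Real.log (D k ω).toReal)) * lam k ^ (-γ) := by
    intro n k
    refine (hV.coord _ k).ae_abs_le_of_holder (hlam k) (by linarith) (by linarith)
      (fun ω ↦ Real.sqrt_nonneg _) ?_
    filter_upwards [(hβ k).cont, hEfin] with ω h1 h2 s hs
    have := hhol T hT (fun t ↦ β k t ω) h1 (hDfin k ω h2) s (hs.trans (min_le_right _ _)) _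
      (min_le_right (TopologicalSpace.denseSeq ℝ≥0 n) T)
    rwa [abs_of_nonneg (sub_nonneg.2 (NNReal.coe_le_coe.2 hs))] at this
  filter_upwards [ae_all_iff.2 fun n ↦ ae_all_iff.2 (hcoord n), hEfin, hV.continuous]
    with ω h1 h2 h3
  refine forall_le_of_forall_denseSeq (F := fun t ↦ ‖V t ω‖ ^ 2) (by fun_prop) fun n ↦ ?_
  have hg1 : 1 ≤ (E ω).toReal := by
    have : (1 : ℝ≥0∞) ≤ E ω := le_self_add
    simpa using ENNReal.toReal_mono h2.ne this
  have hlog := Real.log_nonneg hg1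
  refine hasSum_le_of_sum_le (HilbertBasis.hasSum_inner_sq e _) fun F ↦ ?_
  have hD1 : ∀ k, 1 ≤ (D k ω).toReal := by
    intro k
    have := ENNReal.toReal_mono (hDfin k ω h2) (one_le_dyadicExpSum hc.le T fun t ↦ β k t ω)
    simpa using this
  have hterm : ∀ k, ⟪e k, V (min (TopologicalSpace.denseSeq ℝ≥0 n) T) ω⟫ ^ 2
      ≤ 16 * K * (T : ℝ) ^ δ * (μ k * (1 + Real.log (E ω).toReal)
        + μ k * (D k ω).toReal / (E ω).toReal) := by
    intro k
    have hl := Real.log_nonneg (hD1 k)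
    have h4 := log_le_log_add_div (zero_lt_one.trans_le (hD1 k)) (zero_lt_one.trans_le hg1)
    have h5 : (lam k ^ (-γ)) ^ 2 = μ k := by
      rw [hμ, ← Real.rpow_mul_natCast (hlam k).le]
      congr 1
      push_cast
      rw [hγ]; ring
    have hm := (hμ0 k).le
    calc ⟪e k, V (min (TopologicalSpace.denseSeq ℝ≥0 n) T) ω⟫ ^ 2
        ≤ (4 * √(K * (T : ℝ) ^ δ * (1 + Real.log (D k ω).toReal)) * lam k ^ (-γ)) ^ 2 :=
          sq_le_sq' (abs_le.1 (h1 n k)).1 (abs_le.1 (h1 n k)).2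
      _ = 16 * K * (T : ℝ) ^ δ * (μ k * (1 + Real.log (D k ω).toReal)) := by
          rw [mul_pow, mul_pow, Real.sq_sqrt (by positivity), h5]; ring
      _ ≤ 16 * K * (T : ℝ) ^ δ * (μ k * (1 + (Real.log (E ω).toReal
            + (D k ω).toReal / (E ω).toReal))) := by gcongr
      _ = _ := by ring
  have hsumD : ∑ k ∈ F, μ k * (D k ω).toReal ≤ (E ω).toReal := by
    have h6 : ∑ k ∈ F, ENNReal.ofReal (μ k) * D k ω ≤ E ω :=
      (ENNReal.sum_le_tsum F).trans le_add_self
    have h7 := ENNReal.toReal_mono h2.ne h6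
    rw [ENNReal.toReal_sum fun k _ ↦ ENNReal.mul_ne_top ENNReal.ofReal_ne_top (hDfin k ω h2)] at h7
    simpa [ENNReal.toReal_mul, ENNReal.toReal_ofReal (hμ0 _).le] using h7
  calc ∑ k ∈ F, ⟪e k, V (min (TopologicalSpace.denseSeq ℝ≥0 n) T) ω⟫ ^ 2
      ≤ ∑ k ∈ F, 16 * K * (T : ℝ) ^ δ * (μ k * (1 + Real.log (E ω).toReal)
        + μ k * (D k ω).toReal / (E ω).toReal) := Finset.sum_le_sum fun k _ ↦ hterm k
    _ = 16 * K * (T : ℝ) ^ δ * ((∑ k ∈ F, μ k) * (1 + Real.log (E ω).toReal)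
        + (∑ k ∈ F, μ k * (D k ω).toReal) / (E ω).toReal) := by
        rw [← Finset.mul_sum, Finset.sum_add_distrib, Finset.sum_mul, Finset.sum_div]
    _ ≤ 16 * K * (T : ℝ) ^ δ * (L * (1 + Real.log (E ω).toReal) + 1) := by
        gcongr
        · exact hsum F
        · exact div_le_one_of_le₀ hsumD (by positivity)
    _ ≤ 16 * K * (T : ℝ) ^ δ * ((L + 1) * (1 + Real.log (E ω).toReal)) := by
        gcongr
        linarith
    _ = _ := by ring

end StochasticConvolution

/-! ### Energy inequality and Gronwall. -/

section Energy

/-- Energy inequality for the scalar equation `y' = -l y + g`, `y 0 = 0`. -/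
lemma sq_integral_exp_mul_le {g : ℝ → ℝ} {l t : ℝ} (hl : 0 ≤ l) (ht : 0 ≤ t)
    (hg : IntervalIntegrable g volume 0 t) {y : ℝ → ℝ}
    (hy : ∀ r ∈ Set.Icc 0 t, y r = ∫ s in (0 : ℝ)..r, Real.exp (-l * (r - s)) * g s) :
    y t ^ 2 ≤ 2 * ∫ s in (0 : ℝ)..t, y s * g s := by
  have hg2 : IntervalIntegrable (fun s ↦ Real.exp (l * s) * g s) volume 0 t :=
    hg.continuousOn_mul (by fun_prop)
  set E : ℝ → ℝ := fun r ↦ Real.exp (-l * r) with hE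
  set F : ℝ → ℝ := fun r ↦ ∫ s in (0 : ℝ)..r, Real.exp (l * s) * g s with hF
  have hEac : AbsolutelyContinuousOnInterval E 0 t :=
    ContDiffOn.absolutelyContinuousOnInterval (by fun_prop)
  have hFac : AbsolutelyContinuousOnInterval F 0 t :=
    hg2.absolutelyContinuousOnInterval_intervalIntegral (by simp)
  have hEF := hEac.mul hFac
  have hyEF : ∀ r ∈ Set.Icc 0 t, y r = (E * F) r := by
    intro r hr
    rw [hy r hr, Pi.mul_apply, hE, hF, ← intervalIntegral.integral_const_mul]
    refine intervalIntegral.integral_congr fun s _ ↦ ?_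
    simp only
    rw [← mul_assoc, ← Real.exp_add]
    ring_nf
  have hsq := AbsolutelyContinuousOnInterval.integral_deriv_mul_eq_sub hEF hEF
  have h0 : (E * F) 0 = 0 := by simp [hF]
  rw [h0, zero_mul, sub_zero, ← sq] at hsq
  have hyg : ∫ s in (0 : ℝ)..t, y s * g s = ∫ s in (0 : ℝ)..t, (E * F) s * g s := by
    refine intervalIntegral.integral_congr fun s hs ↦ ?_
    rw [Set.uIcc_of_le ht] at hs
    simp only [hyEF s hs]
  rw [hyEF t ⟨ht, le_rfl⟩, ← hsq, hyg, ← intervalIntegral.integral_const_mul]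
  refine intervalIntegral.integral_mono_ae_restrict ht ?_ ?_ ?_
  · exact (hEF.intervalIntegrable_deriv.mul_continuousOn hEF.continuousOn).add
      (hEF.intervalIntegrable_deriv.continuousOn_mul hEF.continuousOn)
  · exact (hg.continuousOn_mul hEF.continuousOn).const_mul 2
  -- Almost everywhere `(y²)' = 2 y (-l y + g) ≤ 2 y g`; absolute continuity makes this enough, so
  -- `g` need not be continuous.
  · rw [EventuallyLE, ae_restrict_iff' measurableSet_Icc]
    filter_upwards [hg2.ae_hasDerivAt_integral] with s hs hst
    rw [Set.uIcc_of_le ht] at hs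
    have h1 : HasDerivAt F (Real.exp (l * s) * g s) s := hs hst 0 ⟨le_rfl, ht⟩
    have h2 : HasDerivAt E (-l * Real.exp (-l * s)) s := by
      have := ((hasDerivAt_id s).const_mul (-l)).exp
      simpa [hE, mul_comm] using this
    have h3 := (h2.mul h1).deriv
    rw [h3]
    have h4 : E s * (Real.exp (l * s) * g s) = g s := by
      rw [hE, ← mul_assoc, ← Real.exp_add]; simp
    rw [h4]
    have h5 : -l * Real.exp (-l * s) * F s = -l * (E * F) s := by
      rw [Pi.mul_apply]; ring
    rw [h5]
    nlinarith [mul_nonneg hl (sq_nonneg ((E * F) s))]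

variable {H : Type*} [NormedAddCommGroup H] [InnerProductSpace ℝ H] {ι : Type*} [Countable ι]

lemma HilbertBasis.aestronglyMeasurable_of_inner (e : HilbertBasis ι ℝ H) {α : Type*}
    {_ : MeasurableSpace α} {ν : Measure α} {h : α → H}
    (hm : ∀ k, AEMeasurable (fun s ↦ ⟪e k, h s⟫) ν) : AEStronglyMeasurable h ν := by
  refine aestronglyMeasurable_of_tendsto_ae (atTop : Filter (Finset ι))
    (f := fun F s ↦ ∑ k ∈ F, ⟪e k, h s⟫ • e k) (fun F ↦ ?_) (.of_forall fun s ↦ ?_)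
  · exact Finset.aestronglyMeasurable_fun_sum _ fun k _ ↦
      (hm k).aestronglyMeasurable.smul_const (e k)
  · have := e.hasSum_repr (h s)
    simp only [HilbertBasis.repr_apply_apply] at this
    exact this

variable [CompleteSpace H] {A : H →ₗ.[ℝ] H} {e : HilbertBasis ι ℝ H} {lam : ι → ℝ}

/-- Energy inequality for mild solutions of `y' = A y + g`, `y 0 = 0`. -/
lemma IsEigenbasis.norm_sq_le_integral_inner [MeasurableSpace H] [BorelSpace H]
    [SecondCountableTopology H] (he : IsEigenbasis A e lam) (hA : IsSelfAdjoint A)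
    (hlam : ∀ k, 0 < lam k) {Y g : ℝ → H} (hY : Continuous Y) (hg : Measurable g) {T M : ℝ}
    (hgM : ∀ s ∈ Set.Icc 0 T, ‖g s‖ ≤ M)
    (hYg : ∀ t ∈ Set.Icc 0 T, Y t = ∫ s in (0 : ℝ)..t, expOp A (t - s) (g s))
    {t : ℝ} (ht : t ∈ Set.Icc 0 T) :
    ‖Y t‖ ^ 2 ≤ 2 * ∫ s in (0 : ℝ)..t, ⟪Y s, g s⟫ := by
  have hgi : ∀ k, ∀ r ∈ Set.Icc 0 T, IntervalIntegrable (fun s ↦ ⟪e k, g s⟫) volume 0 r := by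
    intro k r hr
    rw [intervalIntegrable_iff_integrableOn_Ioc_of_le hr.1]
    refine Measure.integrableOn_of_bounded (M := M) (by simp) ?_ ?_
    · exact (measurable_const.inner hg).aestronglyMeasurable
    · filter_upwards [ae_restrict_mem measurableSet_Ioc] with s hs
      refine (norm_inner_le_norm _ _).trans ?_
      rw [e.orthonormal.1, one_mul]
      exact hgM s ⟨hs.1.le, hs.2.trans hr.2⟩
  have hcoord : ∀ k, ∀ r ∈ Set.Icc 0 T,
      ⟪e k, Y r⟫ = ∫ s in (0 : ℝ)..r, Real.exp (-lam k * (r - s)) * ⟪e k, g s⟫ := by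
    intro k r hr
    have heq : ∀ j, ∀ s ∈ Set.Ioc 0 r, ⟪e j, expOp A (r - s) (g s)⟫
        = Real.exp (-lam j * (r - s)) * ⟪e j, g s⟫ := fun j s hs ↦
      he.inner_expOp hA hlam (by linarith [hs.2]) _ _
    have hint : IntervalIntegrable (fun s ↦ expOp A (r - s) (g s)) volume 0 r := by
      rw [intervalIntegrable_iff_integrableOn_Ioc_of_le hr.1]
      refine Integrable.mono' (g := fun _ ↦ M) (integrable_const M) ?_ ?_
      · refine HilbertBasis.aestronglyMeasurable_of_inner e fun j ↦ ?_
        have hm : Measurable fun s ↦ Real.exp (-lam j * (r - s)) * ⟪e j, g s⟫ :=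
          (by fun_prop : Measurable fun s ↦ Real.exp (-lam j * (r - s))).mul
            (measurable_const.inner hg)
        refine hm.aemeasurable.congr ?_
        filter_upwards [ae_restrict_mem measurableSet_Ioc] with s hs
        exact (heq j s hs).symm
      · filter_upwards [ae_restrict_mem measurableSet_Ioc] with s hs
        exact (he.norm_expOp_le hA hlam (by linarith [hs.2]) _).trans
          (hgM s ⟨hs.1.le, hs.2.trans hr.2⟩)
    rw [hYg r hr]
    have := ContinuousLinearMap.intervalIntegral_comp_comm (innerSL ℝ (e k)) hint
    simp only [innerSL_apply_apply] at this
    rw [← this]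
    refine intervalIntegral.integral_congr_ae (.of_forall fun s hs ↦ ?_)
    rw [Set.uIoc_of_le hr.1] at hs
    exact heq k s hs
  have hk : ∀ k, ⟪e k, Y t⟫ ^ 2 ≤ 2 * ∫ s in (0 : ℝ)..t, ⟪e k, Y s⟫ * ⟪e k, g s⟫ := fun k ↦
    sq_integral_exp_mul_le (hlam k).le ht.1 (hgi k t ht)
      (fun r hr ↦ hcoord k r ⟨hr.1, hr.2.trans ht.2⟩)
  have hYm : ∀ k, Continuous fun s ↦ ⟪e k, Y s⟫ := fun k ↦ continuous_const.inner hY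
  -- Summing the scalar inequalities avoids requiring `Y s` to lie in the domain of `A`; Bessel
  -- supplies the dominating function.
  have hlim : Tendsto (fun F : Finset ι ↦ ∫ s in (0 : ℝ)..t, ∑ k ∈ F, ⟪e k, Y s⟫ * ⟪e k, g s⟫) atTop
      (𝓝 (∫ s in (0 : ℝ)..t, ⟪Y s, g s⟫)) := by
    refine intervalIntegral.tendsto_integral_filter_of_dominated_convergence
      (fun s ↦ ‖Y s‖ * M) (.of_forall fun F ↦ ?_) (.of_forall fun F ↦ .of_forall fun s hs ↦ ?_)
      ((hY.norm.mul continuous_const).intervalIntegrable _ _) (.of_forall fun s _ ↦ ?_)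
    · exact Finset.aestronglyMeasurable_fun_sum _ fun k _ ↦
        (hYm k).aestronglyMeasurable.mul (measurable_const.inner hg).aestronglyMeasurable
    · rw [Set.uIoc_of_le ht.1] at hs
      rw [Real.norm_eq_abs]
      have hb : ∀ v : H, √(∑ k ∈ F, |⟪e k, v⟫| ^ 2) ≤ ‖v‖ := by
        intro v
        refine Real.sqrt_le_iff.2 ⟨norm_nonneg _, ?_⟩
        simp only [sq_abs]
        exact sum_le_hasSum _ (fun _ _ ↦ sq_nonneg _) (HilbertBasis.hasSum_inner_sq e v)
      calc |∑ k ∈ F, ⟪e k, Y s⟫ * ⟪e k, g s⟫| ≤ ∑ k ∈ F, |⟪e k, Y s⟫| * |⟪e k, g s⟫| := by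
            refine (Finset.abs_sum_le_sum_abs _ _).trans (le_of_eq ?_)
            simp only [abs_mul]
        _ ≤ _ := Real.sum_mul_le_sqrt_mul_sqrt _ _ _
        _ ≤ ‖Y s‖ * ‖g s‖ := by
            gcongr
            · exact hb _
            · exact hb _
        _ ≤ ‖Y s‖ * M := by
            gcongr
            exact hgM s ⟨hs.1.le, hs.2.trans ht.2⟩
    · have := e.hasSum_inner_mul_inner (Y s) (g s)
      simp only [real_inner_comm _ (Y s)] at this ⊢
      exact this
  refine le_of_tendsto_of_tendsto' (HilbertBasis.hasSum_inner_sq e (Y t)) (hlim.const_mul 2)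
    fun F ↦ ?_
  rw [intervalIntegral.integral_finsetSum fun k _ ↦
    (hgi k t ht).continuousOn_mul (hYm k).continuousOn, Finset.mul_sum]
  exact Finset.sum_le_sum fun k _ ↦ hk k

/-- Gronwall is applied to the integral, which vanishes at `0`. The resulting factor tends to `0`
with `t`, as needed for short horizons. -/
lemma le_mul_exp_sub_one_of_le_integral {φ : ℝ → ℝ} (hφ : Continuous φ) {K R T : ℝ} (hK : 0 < K)
    (h : ∀ t ∈ Set.Icc 0 T, φ t ≤ K * ∫ s in (0 : ℝ)..t, (φ s + R)) {t : ℝ}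
    (ht : t ∈ Set.Icc 0 T) : φ t ≤ R * (Real.exp (K * t) - 1) := by
  set Φ : ℝ → ℝ := fun t ↦ ∫ s in (0 : ℝ)..t, (φ s + R) with hΦ
  have hd : ∀ x, HasDerivAt Φ (φ x + R) x := fun x ↦
    (hφ.add continuous_const).integral_hasStrictDerivAt 0 x |>.hasDerivAt
  have hb := le_gronwallBound_of_liminf_deriv_right_le (f := Φ) (f' := fun x ↦ φ x + R) (δ := 0)
    (K := K) (ε := R) (a := 0) (b := T) (fun x _ ↦ (hd x).continuousAt.continuousWithinAt)
    (fun x _ r hr ↦ (hd x).hasDerivWithinAt.liminf_right_slope_le hr) (by simp [hΦ])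
    (fun x hx ↦ by linarith [h x ⟨hx.1, hx.2.le⟩]) t ht
  rw [gronwallBound_of_K_ne_0 hK.ne'] at hb
  simp only [sub_zero, zero_mul, zero_add] at hb
  calc φ t ≤ K * Φ t := h t ht
    _ ≤ K * (R / K * (Real.exp (K * t) - 1)) := by gcongr
    _ = _ := by field_simp

/-- Pathwise a priori bound for the difference between a mild solution and the
Ornstein-Uhlenbeck path that drives it. -/
lemma IsEigenbasis.norm_sub_sq_le [MeasurableSpace H] [BorelSpace H] [SecondCountableTopology H]
    (he : IsEigenbasis A e lam) (hA : IsSelfAdjoint A) (hlam : ∀ k, 0 < lam k)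
    {C p : ℝ} (hC : 0 < C) {B : H → H} (hB : Measurable B) (hBb : LocallyBdd B)
    (hBC : ∀ y z : H, ⟪B (y + z), y⟫ ≤ C * (‖y‖ ^ 2 + Real.exp (p * ‖z‖) + 1))
    {X Z : ℝ≥0 → H} (hX : Continuous X) (hZ : Continuous Z)
    (hXZ : ∀ t : ℝ≥0, X t = Z t + ∫ s in (0 : ℝ)..t, expOp A (t - s) (B (X s.toNNReal)))
    {T : ℝ≥0} {R : ℝ} (hR : ∀ t ≤ T, Real.exp (p * ‖Z t‖) ≤ R) :
    ∀ t ≤ T, ‖X t - Z t‖ ^ 2 ≤ (R + 1) * (Real.exp (2 * C * T) - 1) := by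
  set Y : ℝ → H := fun s ↦ X s.toNNReal - Z s.toNNReal with hY
  have hYc : Continuous Y := by fun_prop
  have hgm : Measurable fun s : ℝ ↦ B (X s.toNNReal) :=
    hB.comp (hX.comp continuous_real_toNNReal).measurable
  obtain ⟨r, hr⟩ := (isCompact_Icc (a := (0 : ℝ)) (b := T)).exists_bound_of_continuousOn
    (hX.comp continuous_real_toNNReal).continuousOn
  obtain ⟨M, hM⟩ := hBb r
  have henergy : ∀ t ∈ Set.Icc (0 : ℝ) T,
      ‖Y t‖ ^ 2 ≤ 2 * ∫ s in (0 : ℝ)..t, ⟪Y s, B (X s.toNNReal)⟫ := fun t ht ↦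
    he.norm_sq_le_integral_inner hA hlam hYc hgm (fun s hs ↦ hM _ (hr s hs))
      (fun t ht ↦ by
        have := hXZ t.toNNReal
        rw [Real.coe_toNNReal _ ht.1] at this
        simp only [hY]
        rw [sub_eq_iff_eq_add', this]) ht
  have hgron : ∀ t ∈ Set.Icc (0 : ℝ) T,
      ‖Y t‖ ^ 2 ≤ 2 * C * ∫ s in (0 : ℝ)..t, (‖Y s‖ ^ 2 + (R + 1)) := by
    intro t ht
    refine (henergy t ht).trans ?_
    rw [mul_assoc, ← intervalIntegral.integral_const_mul C]
    refine mul_le_mul_of_nonneg_left ?_ zero_le_two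
    refine intervalIntegral.integral_mono_on ht.1 ?_ ?_ fun s hs ↦ ?_
    · rw [intervalIntegrable_iff_integrableOn_Ioc_of_le ht.1]
      have hcm : IntegrableOn (fun s ↦ ‖Y s‖ * M) (Set.Ioc 0 t) :=
        ((hYc.norm.mul continuous_const).integrableOn_Icc).mono_set Set.Ioc_subset_Icc_self
      refine hcm.mono' (hYc.measurable.inner hgm).aestronglyMeasurable ?_
      filter_upwards [ae_restrict_mem measurableSet_Ioc] with s hs
      refine (norm_inner_le_norm _ _).trans ?_
      gcongr
      exact hM _ (hr s ⟨hs.1.le, hs.2.trans ht.2⟩)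
    · exact Continuous.intervalIntegrable (by fun_prop) _ _
    · have h1 := hBC (Y s) (Z s.toNNReal)
      have h2 : Y s + Z s.toNNReal = X s.toNNReal := by simp [hY]
      rw [h2, real_inner_comm] at h1
      have h3 := hR s.toNNReal (Real.toNNReal_le_iff_le_coe.2 (hs.2.trans ht.2))
      refine h1.trans ?_
      rw [add_assoc]
      gcongr
  intro t ht
  have ht' : (t : ℝ) ∈ Set.Icc (0 : ℝ) T := ⟨t.2, ht⟩
  have h1 := le_mul_exp_sub_one_of_le_integral (φ := fun s ↦ ‖Y s‖ ^ 2) (by fun_prop)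
    (by positivity) hgron ht'
  simp only [hY, Real.toNNReal_coe] at h1
  refine h1.trans ?_
  have hR0 : 0 ≤ R := (Real.exp_pos _).le.trans (hR 0 zero_le)
  gcongr

end Energy

/-! ### Moment bounds for short and long horizons. -/

section APriori

lemma norm_add_sq_le_young {E : Type*} [SeminormedAddCommGroup E] (x y : E) {ε : ℝ} (hε : 0 < ε) :
    ‖x + y‖ ^ 2 ≤ (1 + ε) * ‖x‖ ^ 2 + (1 + ε⁻¹) * ‖y‖ ^ 2 := by
  have h1 : ‖x + y‖ ^ 2 ≤ (‖x‖ + ‖y‖) ^ 2 := by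
    gcongr
    exact norm_add_le x y
  have h2 : 0 ≤ ε⁻¹ * (ε * ‖x‖ - ‖y‖) ^ 2 := by positivity
  have h3 : ε⁻¹ * (ε * ‖x‖ - ‖y‖) ^ 2 = ε * ‖x‖ ^ 2 + ε⁻¹ * ‖y‖ ^ 2 - 2 * ‖x‖ * ‖y‖ := by
    field_simp
    ring
  nlinarith

lemma sq_le_two_div_sq_mul_exp {p u : ℝ} (hp : 0 < p) (hu : 0 ≤ u) :
    u ^ 2 ≤ 2 / p ^ 2 * Real.exp (p * u) := by
  have h := Real.quadratic_le_exp_of_nonneg (mul_nonneg hp.le hu)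
  have h1 : (p * u) ^ 2 ≤ 2 * Real.exp (p * u) := by nlinarith [mul_nonneg hp.le hu]
  rw [div_mul_eq_mul_div, le_div_iff₀ (by positivity)]
  linarith

lemma exists_iSup_exp_eq_ofReal {H : Type*} [SeminormedAddCommGroup H] {Z : ℝ≥0 → H}
    (hZ : Continuous Z) (p : ℝ) (T : ℝ≥0) :
    ∃ R : ℝ, (∀ t ≤ T, Real.exp (p * ‖Z t‖) ≤ R) ∧
      ⨆ t ∈ Set.Icc 0 T, ENNReal.ofReal (Real.exp (p * ‖Z t‖)) = ENNReal.ofReal R := by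
  obtain ⟨M, hM⟩ := (isCompact_Icc (a := (0 : ℝ≥0)) (b := T)).exists_bound_of_continuousOn
    (f := fun t ↦ Real.exp (p * ‖Z t‖)) (by fun_prop)
  set S := ⨆ t ∈ Set.Icc 0 T, ENNReal.ofReal (Real.exp (p * ‖Z t‖)) with hS
  have hfin : S ≠ ∞ := by
    refine (lt_of_le_of_lt (iSup₂_le fun t ht ↦ ?_) (ENNReal.ofReal_lt_top (r := M))).ne
    exact ENNReal.ofReal_le_ofReal ((le_abs_self _).trans (hM t ht))
  refine ⟨S.toReal, fun t ht ↦ ?_, (ENNReal.ofReal_toReal hfin).symm⟩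
  rw [← ENNReal.ofReal_le_iff_le_toReal hfin]
  exact le_iSup₂ (f := fun t (_ : t ∈ Set.Icc 0 T) ↦ ENNReal.ofReal (Real.exp (p * ‖Z t‖))) t
    ⟨zero_le, ht⟩

lemma exists_pos_forall_le_quarter (C c d : ℝ) {δ : ℝ} (hδ : 0 < δ) :
    ∃ T₀ : ℝ, 0 < T₀ ∧ ∀ T, 0 ≤ T → T ≤ T₀ →
      c * (Real.exp (2 * C * T) - 1) ≤ 1 / 4 ∧ d * T ^ δ ≤ 1 / 4 := by
  have h1 : Tendsto (fun T : ℝ ↦ c * (Real.exp (2 * C * T) - 1)) (𝓝 0) (𝓝 0) := by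
    have : Continuous fun T : ℝ ↦ c * (Real.exp (2 * C * T) - 1) := by fun_prop
    simpa using this.tendsto 0
  have h2 : Tendsto (fun T : ℝ ↦ d * T ^ δ) (𝓝 0) (𝓝 0) := by
    have : Continuous fun T : ℝ ↦ d * T ^ δ :=
      continuous_const.mul (Real.continuous_rpow_const hδ.le)
    simpa [Real.zero_rpow hδ.ne'] using this.tendsto 0
  have h3 := (h1.eventually_le_const (show (0 : ℝ) < 1 / 4 by norm_num)).and
    (h2.eventually_le_const (show (0 : ℝ) < 1 / 4 by norm_num))
  obtain ⟨r, hr, hball⟩ := Metric.eventually_nhds_iff.1 h3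
  refine ⟨r / 2, by positivity, fun T hT0 hT ↦ hball ?_⟩
  rw [Real.dist_0_eq_abs, abs_of_nonneg hT0]
  linarith

/-- Completing the square gives `p‖v‖ ≤ p²a/4 + ‖v‖²/a`. This normalisation makes `log g` appear
with coefficient `1`, so only the first power of `g` is needed. -/
lemma exp_mul_norm_add_le {E : Type*} [SeminormedAddCommGroup E] {x v : E} {p a g : ℝ} (ha : 0 < a) (hp : 0 ≤ p) (hg : 1 ≤ g)
    (hv : ‖v‖ ^ 2 ≤ a * (1 + Real.log g)) :
    Real.exp (p * ‖x + v‖) ≤ Real.exp (p * ‖x‖ + p ^ 2 * a / 4 + 1) * g := by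
  have h1 : p * ‖v‖ ≤ p ^ 2 * a / 4 + ‖v‖ ^ 2 / a := by
    have h : 0 ≤ (p * a / 2 - ‖v‖) ^ 2 / a := by positivity
    have h' : (p * a / 2 - ‖v‖) ^ 2 / a = p ^ 2 * a / 4 + ‖v‖ ^ 2 / a - p * ‖v‖ := by
      field_simp
      ring
    linarith
  have h2 : ‖v‖ ^ 2 / a ≤ 1 + Real.log g := by
    rw [div_le_iff₀ ha]; linarith
  have h3 : p * ‖x + v‖ ≤ p * ‖x‖ + p * ‖v‖ := by
    rw [← mul_add]
    gcongr
    exact norm_add_le x v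
  calc Real.exp (p * ‖x + v‖) ≤ Real.exp (p * ‖x‖ + p ^ 2 * a / 4 + 1 + Real.log g) := by
        gcongr
        linarith
    _ = _ := by rw [Real.exp_add _ (Real.log g), Real.exp_log (by linarith)]

/-- The second moment of `sup |X|` from the pathwise bound on `X - Z`, with a constant that
is affine in the constant of that bound. -/
lemma lintegral_iSup_norm_sq_le {H : Type*} [NormedAddCommGroup H] {Ω : Type*}
    {mΩ : MeasurableSpace Ω} {P : Measure Ω} [IsProbabilityMeasure P] {X Z : ℝ≥0 → Ω → H} {p c : ℝ} (hp : 0 < p) (hc : 0 ≤ c) {T : ℝ≥0}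
    (hZ : ∀ᵐ ω ∂P, Continuous fun t ↦ Z t ω)
    (hXZ : ∀ᵐ ω ∂P, ∀ R : ℝ, (∀ t ≤ T, Real.exp (p * ‖Z t ω‖) ≤ R) →
      ∀ t ≤ T, ‖X t ω - Z t ω‖ ^ 2 ≤ (R + 1) * c) :
    ∫⁻ ω, ⨆ t ∈ Set.Icc 0 T, ENNReal.ofReal (‖X t ω‖ ^ 2) ∂P ≤
      ENNReal.ofReal ((2 + 4 / p ^ 2) * (c + 1)) * (expSupMoment P p Z T + 1) := by
  set c' := (2 + 4 / p ^ 2) * (c + 1) with hc'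
  have h : ∫⁻ ω, (⨆ t ∈ Set.Icc 0 T, ENNReal.ofReal (Real.exp (p * ‖Z t ω‖))) + 1 ∂P
      = expSupMoment P p Z T + 1 := by
    -- Only the constant summand has to be measurable, not the supremum.
    rw [lintegral_add_right _ measurable_const]
    simp [expSupMoment]
  rw [← h, ← lintegral_const_mul' _ _ ENNReal.ofReal_ne_top]
  refine lintegral_mono_ae ?_
  filter_upwards [hZ, hXZ] with ω h1 h2
  obtain ⟨R, hR, hReq⟩ := exists_iSup_exp_eq_ofReal h1 p T
  have hR0 : 0 ≤ R := (Real.exp_pos _).le.trans (hR 0 zero_le)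
  rw [hReq, ← ENNReal.ofReal_one, ← ENNReal.ofReal_add hR0 zero_le_one,
    ← ENNReal.ofReal_mul (by positivity)]
  refine iSup₂_le fun t ht ↦ ENNReal.ofReal_le_ofReal ?_
  have h3 := h2 R hR t ht.2
  have h4 := norm_add_sq_le_young (Z t ω) (X t ω - Z t ω) one_pos
  rw [add_sub_cancel] at h4
  have h5 : ‖Z t ω‖ ^ 2 ≤ 2 / p ^ 2 * R :=
    (sq_le_two_div_sq_mul_exp hp (norm_nonneg _)).trans (by gcongr; exact hR t ht.2)
  have h6 : 0 ≤ 4 / p ^ 2 := by positivity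
  have h7 : 4 / p ^ 2 = 2 * (2 / p ^ 2) := by ring
  calc ‖X t ω‖ ^ 2 ≤ 2 * (2 / p ^ 2 * R) + 2 * ((R + 1) * c) := by
        norm_num at h4; linarith
    _ ≤ c' * (R + 1) := by
        have h8 : 0 ≤ 4 / p ^ 2 * c * (R + 1) := by positivity
        rw [hc']
        nlinarith

variable {H : Type*} [NormedAddCommGroup H] [InnerProductSpace ℝ H] [CompleteSpace H]
  {A : H →ₗ.[ℝ] H} {ι : Type*} {e : HilbertBasis ι ℝ H} {lam : ι → ℝ}
  {Ω : Type*} {mΩ : MeasurableSpace Ω} {P : Measure Ω} {G : Ω → ℝ} {Z : ℝ≥0 → Ω → H}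

lemma IsEigenbasis.expSupMoment_lt_top (he : IsEigenbasis A e lam) (hA : IsSelfAdjoint A)
    (hlam : ∀ k, 0 < lam k) {p : ℝ} (hp : 0 ≤ p) {x : H} {T : ℝ≥0} {a N : ℝ} (ha : 0 < a)
    (hG1 : ∀ᵐ ω ∂P, 1 ≤ G ω) (hGN : ∫⁻ ω, ENNReal.ofReal (G ω) ∂P ≤ ENNReal.ofReal N)
    (hGV : ∀ᵐ ω ∂P, ∀ t ≤ T, ‖Z t ω - expOp A t x‖ ^ 2 ≤ a * (1 + Real.log (G ω))) :
    expSupMoment P p Z T < ∞ := by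
  set c := Real.exp (p * ‖x‖ + p ^ 2 * a / 4 + 1) with hc
  calc expSupMoment P p Z T ≤ ∫⁻ ω, ENNReal.ofReal c * ENNReal.ofReal (G ω) ∂P := by
        refine lintegral_mono_ae ?_
        filter_upwards [hG1, hGV] with ω h1 h2
        refine iSup₂_le fun t ht ↦ ?_
        rw [← ENNReal.ofReal_mul (Real.exp_pos _).le]
        refine ENNReal.ofReal_le_ofReal ?_
        have h3 := exp_mul_norm_add_le (x := expOp A t x) ha hp h1 (h2 t ht.2)
        rw [add_sub_cancel] at h3
        refine h3.trans ?_
        have := he.norm_expOp_le hA hlam t.coe_nonneg x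
        gcongr
    _ = ENNReal.ofReal c * ∫⁻ ω, ENNReal.ofReal (G ω) ∂P :=
        lintegral_const_mul' _ _ ENNReal.ofReal_ne_top
    _ < ∞ := ENNReal.mul_lt_top ENNReal.ofReal_lt_top (hGN.trans_lt ENNReal.ofReal_lt_top)

variable [IsProbabilityMeasure P] {X : ℝ≥0 → Ω → H}

/-- The second moment of `sup |X|` over a short time horizon. -/
lemma IsEigenbasis.lintegral_iSup_norm_sq_le_of_small (he : IsEigenbasis A e lam)
    (hA : IsSelfAdjoint A) (hlam : ∀ k, 0 < lam k) {p c : ℝ} (hp : 0 < p) {x : H} {T : ℝ≥0}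
    {a N : ℝ} (ha : 0 < a) (hGm : AEMeasurable G P) (hG1 : ∀ᵐ ω ∂P, 1 ≤ G ω)
    (hGN : ∫⁻ ω, ENNReal.ofReal (G ω) ∂P ≤ ENNReal.ofReal N)
    (hGV : ∀ᵐ ω ∂P, ∀ t ≤ T, ‖Z t ω - expOp A t x‖ ^ 2 ≤ a * (1 + Real.log (G ω)))
    (hZ0 : ∀ᵐ ω ∂P, Z 0 ω = x) (hZ : ∀ᵐ ω ∂P, Continuous fun t ↦ Z t ω)
    (hXZ : ∀ᵐ ω ∂P, ∀ R : ℝ, (∀ t ≤ T, Real.exp (p * ‖Z t ω‖) ≤ R) →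
      ∀ t ≤ T, ‖X t ω - Z t ω‖ ^ 2 ≤ (R + 1) * c)
    (hc : (1 + (p ^ 2 / 8)⁻¹) * c ≤ 1 / 4) (haN : (1 + (p ^ 2 / 8)⁻¹) * a * N ≤ 1 / 4) :
    ∫⁻ ω, ⨆ t ∈ Set.Icc 0 T, ENNReal.ofReal (‖X t ω‖ ^ 2) ∂P ≤
      ENNReal.ofReal (‖x‖ ^ 2) + expSupMoment P p Z T + 1 := by
  -- Chosen so that `ε u² ≤ exp (p u) / 4` for `u ≥ 0`.
  set ε := p ^ 2 / 8 with hε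
  have hε0 : 0 < ε := by positivity
  have hεp : ε * (2 / p ^ 2) = 1 / 4 := by rw [hε]; field_simp; norm_num
  set q := (1 + ε⁻¹) * a with hq
  have hq0 : 0 < q := by positivity
  have hle : ∫⁻ ω, ⨆ t ∈ Set.Icc 0 T, ENNReal.ofReal (‖X t ω‖ ^ 2) ∂P ≤
      ∫⁻ ω, (⨆ t ∈ Set.Icc 0 T, ENNReal.ofReal (Real.exp (p * ‖Z t ω‖)))
        + (ENNReal.ofReal (‖x‖ ^ 2 + 1 / 4) + ENNReal.ofReal q * ENNReal.ofReal (G ω)) ∂P := by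
    refine lintegral_mono_ae ?_
    filter_upwards [hZ, hXZ, hG1, hGV, hZ0] with ω h1 h2 h3 h4 h5
    obtain ⟨R, hR, hReq⟩ := exists_iSup_exp_eq_ofReal h1 p T
    have hR0 : 0 ≤ R := (Real.exp_pos _).le.trans (hR 0 zero_le)
    rw [hReq, ← ENNReal.ofReal_mul hq0.le, ← ENNReal.ofReal_add (by positivity) (by positivity),
      ← ENNReal.ofReal_add hR0 (by positivity)]
    refine iSup₂_le fun t ht ↦ ENNReal.ofReal_le_ofReal ?_
    have hRle : ∀ {s : ℝ≥0}, s ≤ T → ε * ‖Z s ω‖ ^ 2 ≤ 1 / 4 * R := by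
      intro s hs
      rw [← hεp, mul_assoc]
      gcongr
      exact (sq_le_two_div_sq_mul_exp hp (norm_nonneg _)).trans (by gcongr; exact hR s hs)
    have h6 := norm_add_sq_le_young (Z t ω) (X t ω - Z t ω) hε0
    have h7 := norm_add_sq_le_young (expOp A t x) (Z t ω - expOp A t x) hε0
    rw [add_sub_cancel] at h6 h7
    have h8 : ‖expOp A t x‖ ^ 2 ≤ ‖x‖ ^ 2 := by
      have := he.norm_expOp_le hA hlam t.coe_nonneg x
      gcongr
    have h9 := hRle (zero_le : 0 ≤ T)
    rw [h5] at h9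
    have h10 := hRle ht.2
    have h11 : (1 + ε⁻¹) * ‖X t ω - Z t ω‖ ^ 2 ≤ 1 / 4 * (R + 1) := by
      calc (1 + ε⁻¹) * ‖X t ω - Z t ω‖ ^ 2 ≤ (1 + ε⁻¹) * ((R + 1) * c) := by
            gcongr
            exact h2 R hR t ht.2
        _ = (1 + ε⁻¹) * c * (R + 1) := by ring
        _ ≤ _ := by gcongr
    have h12 : (1 + ε⁻¹) * ‖Z t ω - expOp A t x‖ ^ 2 ≤ q * G ω := by
      rw [hq, mul_assoc]
      gcongr
      refine (h4 t ht.2).trans ?_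
      gcongr
      linarith [Real.log_le_sub_one_of_pos (zero_lt_one.trans_le h3)]
    have h13 : ε * ‖expOp A t x‖ ^ 2 ≤ ε * ‖x‖ ^ 2 := by gcongr
    linarith
  refine hle.trans ?_
  rw [lintegral_add_right' _ (by fun_prop), lintegral_add_left measurable_const,
    lintegral_const_mul' _ _ ENNReal.ofReal_ne_top]
  have h14 : ENNReal.ofReal q * ∫⁻ ω, ENNReal.ofReal (G ω) ∂P ≤ ENNReal.ofReal (1 / 4) := by
    calc _ ≤ ENNReal.ofReal q * ENNReal.ofReal N := by gcongr
      _ = ENNReal.ofReal (q * N) := (ENNReal.ofReal_mul hq0.le).symm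
      _ ≤ _ := ENNReal.ofReal_le_ofReal haN
  simp only [lintegral_const, measure_univ, mul_one]
  calc _ ≤ expSupMoment P p Z T + (ENNReal.ofReal (‖x‖ ^ 2 + 1 / 4) + ENNReal.ofReal (1 / 4)) := by
        rw [expSupMoment]
        gcongr
    _ ≤ expSupMoment P p Z T + ENNReal.ofReal (‖x‖ ^ 2 + 1) := by
        rw [← ENNReal.ofReal_add (by positivity) (by positivity)]
        gcongr _ + ?_
        exact ENNReal.ofReal_le_ofReal (by linarith)
    _ = _ := by
        rw [ENNReal.ofReal_add (by positivity) zero_le_one, ENNReal.ofReal_one]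
        ring

end APriori

end OUDrift

/-! ### Choice of the constant and conclusion. -/

theorem mainTheorem5 {H : Type*} [NormedAddCommGroup H] [InnerProductSpace ℝ H] [CompleteSpace H]
    [TopologicalSpace.SeparableSpace H] [MeasurableSpace H] [BorelSpace H]
    (A : H →ₗ.[ℝ] H) (hA : OUDrift.Hypothesis1 A)
    (C p : ℝ) (hC : 0 < C) (hp : 0 < p) :
    ∃ Cp : ℝ, 0 < Cp ∧
      ∀ B : H → H, Measurable B → OUDrift.LocallyBdd B →
        (∀ y z : H, ⟪B (y + z), y⟫ ≤ C * (‖y‖ ^ 2 + Real.exp (p * ‖z‖) + 1)) →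
      ∀ (ι : Type*) (e : HilbertBasis ι ℝ H) (lam : ι → ℝ), OUDrift.IsEigenbasis A e lam →
      ∀ (Ω : Type*) (mΩ : MeasurableSpace Ω) (𝓕 : Filtration ℝ≥0 mΩ) (P : Measure Ω),
        IsProbabilityMeasure P →
      ∀ (β : ι → ℝ≥0 → Ω → ℝ) (x : H) (X Z : ℝ≥0 → Ω → H),
        OUDrift.IsWeakMildSolution A B x e lam 𝓕 P β X →
        OUDrift.IsOrnsteinUhlenbeck A P e lam β x Z →
      ∀ T : ℝ≥0, 0 < T →
        OUDrift.expSupMoment P p Z T < ∞ ∧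
        ∫⁻ ω, ⨆ t ∈ Set.Icc 0 T, ENNReal.ofReal (‖X t ω‖ ^ 2) ∂P ≤
          ENNReal.ofReal (Real.exp (Cp * T)) *
            (ENNReal.ofReal (‖x‖ ^ 2) + OUDrift.expSupMoment P p Z T + 1) := by
  obtain ⟨δ, hδ0, hδ1, -, htr⟩ := hA.traceClass
  obtain ⟨L, hL, hsum⟩ :=
    OUDrift.exists_sum_rpow_le (by linarith : 0 < 1 - δ) hA.selfAdjoint hA.negDef htr
  obtain ⟨a, N, ha, hN, hG⟩ := OUDrift.exists_sup_stochasticConvolution_le hδ0 hδ1 hL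
  obtain ⟨T₀, hT₀, hsmall⟩ := OUDrift.exists_pos_forall_le_quarter C (1 + (p ^ 2 / 8)⁻¹)
    ((1 + (p ^ 2 / 8)⁻¹) * a * N) hδ0
  set c₁ : ℝ := 2 + 4 / p ^ 2 with hc₁
  have hc₁1 : 1 ≤ c₁ := by
    have : 0 < 4 / p ^ 2 := by positivity
    linarith
  have hlog := Real.log_nonneg hc₁1
  -- The term `2 * C` is the Gronwall rate; the other absorbs the prefactor `c₁` once `T ≥ T₀`.
  refine ⟨2 * C + Real.log c₁ / T₀, by positivity, ?_⟩
  intro B hB hBb hBC ι e lam he Ω mΩ 𝓕 P hP β x X Z hX hZ T hT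
  have hlam := he.lam_pos hA.negDef
  have : Countable ι := OUDrift.HilbertBasis.countable e
  have hsc : SecondCountableTopology H := UniformSpace.secondCountable_of_separable H
  obtain ⟨hZc, hZV⟩ := hZ
  have hT' : (0 : ℝ) < T := hT
  obtain ⟨G, hGm, hG1, hGN, hGV⟩ := hG e lam hlam (hsum ι e lam he) P β hX.wiener.brownian _ hZV T hT
  have haT : 0 < a * (T : ℝ) ^ δ := by positivity
  refine ⟨he.expSupMoment_lt_top hA.selfAdjoint hlam hp.le haT hG1 hGN hGV, ?_⟩
  have hXZ : ∀ᵐ ω ∂P, ∀ R : ℝ, (∀ t ≤ T, Real.exp (p * ‖Z t ω‖) ≤ R) →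
      ∀ t ≤ T, ‖X t ω - Z t ω‖ ^ 2 ≤ (R + 1) * (Real.exp (2 * C * T) - 1) := by
    obtain ⟨V, hV, hmild⟩ := hX.mild
    filter_upwards [hV.ae_eq hZV, hmild, hX.continuous, hZc] with ω h1 h2 h3 h4 R hR
    refine he.norm_sub_sq_le hA.selfAdjoint hlam hC hB hBb hBC h3 h4 (fun t ↦ ?_) hR
    rw [h2 t, h1 t]
    abel
  have hexp1 : 1 ≤ Real.exp (2 * C * T) := Real.one_le_exp (by positivity)
  rcases le_total (T : ℝ) T₀ with hle | hle
  · obtain ⟨hs1, hs2⟩ := hsmall T hT'.le hle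
    have hZ0 : ∀ᵐ ω ∂P, Z 0 ω = x := by
      filter_upwards [hZV.ae_eq_zero_at_zero] with ω h
      simpa [OUDrift.expOp, sub_eq_zero] using h
    refine (he.lintegral_iSup_norm_sq_le_of_small hA.selfAdjoint hlam hp haT hGm hG1 hGN hGV
      hZ0 hZc hXZ hs1 (by linarith)).trans ?_
    refine le_mul_of_one_le_left zero_le ?_
    rw [← ENNReal.ofReal_one]
    exact ENNReal.ofReal_le_ofReal (Real.one_le_exp (by positivity))
  · refine (OUDrift.lintegral_iSup_norm_sq_le hp (by linarith) hZc hXZ).trans ?_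
    rw [sub_add_cancel, ← hc₁]
    refine mul_le_mul' (ENNReal.ofReal_le_ofReal ?_) ?_
    · have : Real.exp ((2 * C + Real.log c₁ / T₀) * T)
          = Real.exp (Real.log c₁ / T₀ * T) * Real.exp (2 * C * T) := by
        rw [← Real.exp_add]
        ring_nf
      rw [this]
      gcongr
      rw [← Real.log_le_iff_le_exp (by linarith), div_mul_eq_mul_div, le_div_iff₀ hT₀]
      gcongr
    · gcongr
      exact le_add_self
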